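/- Let $\mathbf P_i$ ($i=1,2$) be real finite-dimensional linear time-invariant systems $\dot x=A_ix+B_iu$, $y=C_ix+D_iu$ with the same numbers of inputs and of outputs, with transfer functions $P_i(s)=C_i(sI-A_i)^{-1}B_i+D_i$, and let $\mu_i$ be the McMillan degree of $P_i$ (the least state dimension of a realization of $P_i$). Let $P_i=n_im_i^{-1}$ with $n_i,m_i$ right-coprime real polynomial matrices. A polynomial is called Hurwitz if all its complex zeros have negative real part. Let $d_i$ be a square real polynomial matrix with $n_i(-s)^Tn_i(s)+m_i(-s)^Tm_i(s)=d_i(-s)^Td_i(s)$ and $\det d_i$ Hurwitz, let $G_i(s)=\begin{pmatrix} m_i(s)d_i(s)^{-1}\\ n_i(s)d_i(s)^{-1}\end{pmatrix}$ be the graph symbol of $\mathbf P_i$, and put $\mathcal G_i=G_i\,L_2(i\mathbb R)$ and $\delta_{L_2}(\mathbf P_1,\mathbf P_2)=\|\Pi_{\mathcal G_1}-\Pi_{\mathcal G_2}\|$, where $\Pi$ denotes orthogonal projection. The v-gap $\delta_v(\mathbf P_1,\mathbf P_2)$ is $\delta_{L_2}(\mathbf P_1,\mathbf P_2)$ if the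 winding number about the origin of $\det(G_2(-s)^TG_1(s))$, as $s$ traces the Nyquist D-contour (the imaginary axis closed by a large half-circle in the right half-plane), is defined and equal to $0$, and it is $1$ otherwise. The time-conjugate system $\mathfrak J(\mathbf P)$ is $-\dot x=Ax+Bu$, $y=Cx+Du$. Put $\delta_{v,f}(\mathbf P_1,\mathbf P_2)=\delta_v(\mathbf P_1,\mathbf P_2)$ and $\delta_{v,b}(\mathbf P_1,\mathbf P_2)=\delta_v(\mathfrak J(\mathbf P_1),\mathfrak J(\mathbf P_2))$. (The $d_i$ exist, and none of these quantities depends on the choices made.) Let $h(s)=\det\bigl(m_2(-s)^Tm_1(s)+n_2(-s)^Tn_1(s)\bigr)$ and assume $\delta_{L_2}(\mathbf P_1,\mathbf P_2)<1$. Then $h$ has a factorization $h=h_+h_-$ into real polynomials such that $h_+(s)$ and $h_-(-s)$ are Hurwitz, and for every such factorization: 1) the following are equivalent: (a) $\delta_{v,f}(\mathbf P_1,\mathbf P_2)<1$; (b) $\deg h_+=\mu_1$; (c) $\deg h_-=\mu_2$. 2) the following are equivalent: (a) $\delta_{v,b}(\mathbf P_1,\mathbf P_2)<1$; (b) $\deg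 h_-=\mu_1$; (c) $\deg h_+=\mu_2$. 3) the following are equivalent: (a) $\delta_{v,f}(\mathbf P_1,\mathbf P_2)=\delta_{v,b}(\mathbf P_1,\mathbf P_2)<1$; (b) $\mu_1=\mu_2=\deg h_+=\deg h_-$. -/

import Mathlib

open Polynomial Filter MeasureTheory
open scoped Matrix

noncomputable section

/-! ### Finite-dimensional linear time-invariant systems -/

/-- A real finite-dimensional linear time-invariant system `ẋ = A x + B u`, `y = C x + D u`
with `k` inputs and `p` outputs. -/
structure LTISystem (k p : ℕ) where
  order : ℕ
  A : Matrix (Fin order) (Fin order) ℝ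
  B : Matrix (Fin order) (Fin k) ℝ
  C : Matrix (Fin p) (Fin order) ℝ
  D : Matrix (Fin p) (Fin k) ℝ

/-- The transfer function `C (s I - A)⁻¹ B + D`. -/
def LTISystem.transferFunction {k p : ℕ} (S : LTISystem k p) :
    Matrix (Fin p) (Fin k) (RatFunc ℝ) :=
  S.C.map RatFunc.C *
      ((RatFunc.X : RatFunc ℝ) • (1 : Matrix (Fin S.order) (Fin S.order) (RatFunc ℝ))
        - S.A.map RatFunc.C)⁻¹ *
      S.B.map RatFunc.C
    + S.D.map RatFunc.C

/-- The time-conjugate system `-ẋ = A x + B u`, `y = C x + D u`. -/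
def LTISystem.timeConj {k p : ℕ} (S : LTISystem k p) : LTISystem k p where
  order := S.order
  A := -S.A
  B := -S.B
  C := S.C
  D := S.D

/-- The McMillan degree: the least state dimension of a realization of the transfer function. -/
def LTISystem.mcMillanDegree {k p : ℕ} (S : LTISystem k p) : ℕ :=
  sInf {r | ∃ T : LTISystem k p, T.order = r ∧ T.transferFunction = S.transferFunction}

/-! ### Polynomial fractions and spectral factors -/

/-- All complex zeros lie in the open left half-plane (in particular the polynomial is nonzero). -/
def IsHurwitz (q : ℝ[X]) : Prop :=
  ∀ z : ℂ, aeval z q = 0 → z.re < 0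

/-- The polynomial matrix `M(-s)ᵀ`. -/
def paraTranspose {a b : ℕ} (M : Matrix (Fin a) (Fin b) ℝ[X]) : Matrix (Fin b) (Fin a) ℝ[X] :=
  (M.map fun q => q.comp (-X))ᵀ

/-- `P = N M⁻¹` with `N`, `M` right-coprime polynomial matrices. -/
structure IsRightCoprimeFraction {k p : ℕ} (P : Matrix (Fin p) (Fin k) (RatFunc ℝ))
    (N : Matrix (Fin p) (Fin k) ℝ[X]) (M : Matrix (Fin k) (Fin k) ℝ[X]) : Prop where
  coprime : ∃ (U : Matrix (Fin k) (Fin k) ℝ[X]) (V : Matrix (Fin k) (Fin p) ℝ[X]),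
    U * M + V * N = 1
  det_ne_zero : M.det ≠ 0
  eq_mul_inv : P =
    N.map (algebraMap ℝ[X] (RatFunc ℝ)) * (M.map (algebraMap ℝ[X] (RatFunc ℝ)))⁻¹

/-- `N(-s)ᵀ N(s) + M(-s)ᵀ M(s) = d(-s)ᵀ d(s)` with `det d` Hurwitz. -/
structure IsSpectralFactor {k p : ℕ} (N : Matrix (Fin p) (Fin k) ℝ[X])
    (M d : Matrix (Fin k) (Fin k) ℝ[X]) : Prop where
  factor : paraTranspose N * N + paraTranspose M * M = paraTranspose d * d
  hurwitz : IsHurwitz d.det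

/-- The value at `s : ℂ` of a real polynomial matrix. -/
def evalMatrix {a b : ℕ} (s : ℂ) (M : Matrix (Fin a) (Fin b) ℝ[X]) :
    Matrix (Fin a) (Fin b) ℂ :=
  M.map fun q => aeval s q

/-- `G` is a graph symbol of `P`: `G(s)` is the column of `M(s) d(s)⁻¹` and `N(s) d(s)⁻¹` for a
right-coprime fraction `P = N M⁻¹` and a spectral factor `d`. -/
def IsGraphSymbol {k p : ℕ} (P : Matrix (Fin p) (Fin k) (RatFunc ℝ))
    (G : ℂ → Matrix (Fin k ⊕ Fin p) (Fin k) ℂ) : Prop :=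
  ∃ (N : Matrix (Fin p) (Fin k) ℝ[X]) (M d : Matrix (Fin k) (Fin k) ℝ[X]),
    IsRightCoprimeFraction P N M ∧ IsSpectralFactor N M d ∧
    ∀ s : ℂ, G s = Matrix.fromRows
      (evalMatrix s M * (evalMatrix s d)⁻¹) (evalMatrix s N * (evalMatrix s d)⁻¹)

/-- A graph symbol of the system `S`. Graph symbols exist, and are unique up to right
multiplication by a constant orthogonal matrix, on which nothing below depends. -/
def LTISystem.graphSymbol {k p : ℕ} (S : LTISystem k p) :
    ℂ → Matrix (Fin k ⊕ Fin p) (Fin k) ℂ :=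
  Classical.epsilon (IsGraphSymbol S.transferFunction)

/-! ### The gap on the imaginary axis -/

/-- Square-integrable vector functions on the imaginary axis, parametrized by the frequency. -/
abbrev AxisL2 (ι : Type) [Fintype ι] : Type :=
  Lp (EuclideanSpace ℂ ι) 2 (volume : Measure ℝ)

/-- The subspace `G L₂` of the square-integrable functions on the imaginary axis. -/
def symbolRange {k p : ℕ} (G : ℂ → Matrix (Fin k ⊕ Fin p) (Fin k) ℂ) :
    Submodule ℂ (AxisL2 (Fin k ⊕ Fin p)) where
  carrier := {f | ∃ w : AxisL2 (Fin k),
    ∀ᵐ ω : ℝ, (f ω).ofLp = G (ω * Complex.I) *ᵥ (w ω).ofLp}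
  zero_mem' := by
    refine ⟨0, ?_⟩
    filter_upwards [Lp.coeFn_zero (EuclideanSpace ℂ (Fin k ⊕ Fin p)) 2 (volume : Measure ℝ),
      Lp.coeFn_zero (EuclideanSpace ℂ (Fin k)) 2 (volume : Measure ℝ)] with ω h1 h2
    rw [h1, h2]
    simp
  add_mem' := by
    rintro f g ⟨v, hv⟩ ⟨w, hw⟩
    refine ⟨v + w, ?_⟩
    filter_upwards [hv, hw, Lp.coeFn_add f g, Lp.coeFn_add v w] with ω h1 h2 h3 h4
    rw [h3, h4]
    simp [h1, h2, Matrix.mulVec_add]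
  smul_mem' := by
    rintro c f ⟨v, hv⟩
    refine ⟨c • v, ?_⟩
    filter_upwards [hv, Lp.coeFn_smul c f, Lp.coeFn_smul c v] with ω h1 h3 h4
    rw [h3, h4]
    simp [h1, Matrix.mulVec_smul]

/-- The orthogonal projection onto the graph `G L₂` of the system (this subspace is closed, so
that the closure changes nothing). -/
def LTISystem.graphProjection {k p : ℕ} (S : LTISystem k p) :
    AxisL2 (Fin k ⊕ Fin p) →L[ℂ] AxisL2 (Fin k ⊕ Fin p) :=
  (symbolRange S.graphSymbol).topologicalClosure.starProjection

/-- The `L₂`-gap: the norm of the difference of the projections onto the graphs. -/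
def gapL2 {k p : ℕ} (S₁ S₂ : LTISystem k p) : ℝ :=
  ‖S₁.graphProjection - S₂.graphProjection‖

/-! ### Winding numbers and the v-gap -/

/-- The Nyquist D-contour of radius `R`: the segment `[-iR, iR]` and the half-circle of radius `R`
in the closed right half-plane. -/
def nyquistContour (R : ℝ) : Set ℂ :=
  {s | s.re = 0 ∧ |s.im| ≤ R} ∪ {s | 0 ≤ s.re ∧ ‖s‖ = R}

/-- The integral of `f` along the D-contour: up the imaginary axis from `-iR` to `iR`, then back
along the half-circle in the right half-plane. -/
def nyquistIntegral (f : ℂ → ℂ) (R : ℝ) : ℂ :=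
  (∫ ω in (-R)..R, f (ω * Complex.I) * Complex.I) -
    ∫ θ in (-(Real.pi / 2))..(Real.pi / 2),
      f (R * Complex.exp (θ * Complex.I)) * (R * Complex.exp (θ * Complex.I) * Complex.I)

/-- The winding number of `g` about the origin along the D-contour is defined and equals `w`:
for all large `R`, `g` is analytic without zeros on the contour, and
`(2πi)⁻¹ ∮ g'(s) / g(s) ds = w`. -/
def HasWno (g : ℂ → ℂ) (w : ℤ) : Prop :=
  ∀ᶠ R : ℝ in atTop,
    (∀ s ∈ nyquistContour R, AnalyticAt ℂ g s ∧ g s ≠ 0) ∧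
    (2 * Real.pi * Complex.I)⁻¹ * nyquistIntegral (logDeriv g) R = w

open scoped Classical in
/-- The v-gap: the `L₂`-gap if `wno (det (G₂(-s)ᵀ G₁(s))) = 0`, and `1` otherwise. -/
def vGap {k p : ℕ} (S₁ S₂ : LTISystem k p) : ℝ :=
  if HasWno (fun s => ((S₂.graphSymbol (-s))ᵀ * S₁.graphSymbol s).det) 0 then gapL2 S₁ S₂ else 1

/-- The forward v-gap. -/
def vGapForward {k p : ℕ} (S₁ S₂ : LTISystem k p) : ℝ := vGap S₁ S₂

/-- The backward v-gap: the v-gap of the time-conjugate systems. -/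
def vGapBackward {k p : ℕ} (S₁ S₂ : LTISystem k p) : ℝ := vGap S₁.timeConj S₂.timeConj

/-! ### The polynomial `h` and its canonical factorization -/

/-- `h(s) = det (m₂(-s)ᵀ m₁(s) + n₂(-s)ᵀ n₁(s))`. -/
def crossDet {k p : ℕ} (n₁ : Matrix (Fin p) (Fin k) ℝ[X]) (m₁ : Matrix (Fin k) (Fin k) ℝ[X])
    (n₂ : Matrix (Fin p) (Fin k) ℝ[X]) (m₂ : Matrix (Fin k) (Fin k) ℝ[X]) : ℝ[X] :=
  (paraTranspose m₂ * m₁ + paraTranspose n₂ * n₁).det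

/-- `h = h₊ h₋` with `h₊(s)` and `h₋(-s)` Hurwitz. -/
structure IsCanonicalFactorization (h hplus hminus : ℝ[X]) : Prop where
  eq_mul : h = hplus * hminus
  plus : IsHurwitz hplus
  minus : IsHurwitz (hminus.comp (-X))

end

/-!
The v-gap theorem for two systems `P₁`, `P₂` with right-coprime fractions `nᵢ mᵢ⁻¹` is a count of
the zeros of `h(s) = det (m₂(-s)ᵀ m₁(s) + n₂(-s)ᵀ n₁(s))` in the two half-planes.

Graph symbols exist by matrix spectral factorization (`exists_spectral_factor`). Given `Φ` with
`Φ(-s)ᵀ = Φ(s)`, positive definite on the imaginary axis, an irreducible factor `q` of `det Φ` with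
zeros in the left half-plane is split off as `Φ = T(-s)ᵀ Φ' T` with `det T = q`
(`exists_extraction`), until `det Φ` is constant; then unimodular congruences lower the diagonal
degrees (`exists_unimodular_factor`) until `Φ` is a constant positive definite matrix. As coprime
fractions are unique up to a unimodular factor, the chosen graph symbol may be computed from the
given fraction (`LTISystem.exists_graphSymbol_eq`).

All degrees in play are McMillan degrees. The polynomial inputs modulo the multiples of `m`, that
is `ℝ[s]ᵏ / m ℝ[s]ᵏ`, form the state space of a minimal realization, and this space has dimension
`deg det m` (`LTISystem.mcMillanDegree_eq_natDegree_det`). Properness of the transfer function gives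
`deg det d = deg det m` for every spectral factor `d` (`LTISystem.natDegree_det_spectralFactor`).

On the axis `det (G₂(-s)ᵀ G₁(s)) = h(s) / (det d₂(-s) det d₁(s))` is bounded, since the graph
symbols `G₁`, `G₂` are isometric there, and it is bounded away from zero if the `L₂`-gap is less
than `1`. Hence `h` has no zeros on the axis and `deg h = μ₁ + μ₂` (`crossDet_axis_and_natDegree`).
By the argument principle the winding number of this determinant along the D-contour is
`μ₂ - deg h₋` (`hasWno_zero_iff`), so that the v-gap is less than `1` exactly if `deg h₋ = μ₂`,
equivalently `deg h₊ = μ₁`.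

Time conjugation substitutes `-s` for `s`. It preserves the `L₂`-gap, as the unitary reflection
`f(iω) ↦ f(-iω)` carries graphs to graphs (`gapL2_timeConj`), and it exchanges the roles of `h₊` and
`h₋`. This gives the claim for the backward v-gap; and when both v-gaps are less than `1` they both
equal the `L₂`-gap.
-/

/-! ### Para-transposes and values of polynomial matrices -/

section ParaTranspose

variable {a b c : ℕ}

theorem paraTranspose_apply (M : Matrix (Fin a) (Fin b) ℝ[X]) (i : Fin b) (j : Fin a) :
    paraTranspose M i j = (M j i).comp (-X) := rfl

theorem paraTranspose_mul (M : Matrix (Fin a) (Fin b) ℝ[X]) (N : Matrix (Fin b) (Fin c) ℝ[X]) :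
    paraTranspose (M * N) = paraTranspose N * paraTranspose M := by
  have h : (M * N).map (compRingHom (-X : ℝ[X])) = M.map (compRingHom (-X)) * N.map _ :=
    Matrix.map_mul
  exact (congrArg Matrix.transpose h).trans (Matrix.transpose_mul _ _)

theorem paraTranspose_add (M N : Matrix (Fin a) (Fin b) ℝ[X]) :
    paraTranspose (M + N) = paraTranspose M + paraTranspose N := by
  ext1 i j
  simp [paraTranspose_apply]

theorem paraTranspose_paraTranspose (M : Matrix (Fin a) (Fin b) ℝ[X]) :
    paraTranspose (paraTranspose M) = M := by
  ext1 i j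
  simp [paraTranspose_apply, comp_neg_X_comp_neg_X]

theorem paraTranspose_one : paraTranspose (1 : Matrix (Fin a) (Fin a) ℝ[X]) = 1 := by
  ext1 i j
  rw [paraTranspose_apply]
  by_cases h : i = j
  · subst h; simp
  · simp [Matrix.one_apply_ne h, Matrix.one_apply_ne (Ne.symm h)]

theorem det_map_comp_neg_X (M : Matrix (Fin a) (Fin a) ℝ[X]) :
    (M.map fun q => q.comp (-X)).det = M.det.comp (-X) :=
  ((compRingHom (-X : ℝ[X])).map_det M).symm

theorem det_paraTranspose (M : Matrix (Fin a) (Fin a) ℝ[X]) :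
    (paraTranspose M).det = M.det.comp (-X) := by
  rw [paraTranspose, Matrix.det_transpose, det_map_comp_neg_X]

end ParaTranspose

section EvalMatrix

variable {a b c : ℕ} (s : ℂ)

theorem evalMatrix_apply (M : Matrix (Fin a) (Fin b) ℝ[X]) (i : Fin a) (j : Fin b) :
    evalMatrix s M i j = aeval s (M i j) := rfl

theorem evalMatrix_mul (M : Matrix (Fin a) (Fin b) ℝ[X]) (N : Matrix (Fin b) (Fin c) ℝ[X]) :
    evalMatrix s (M * N) = evalMatrix s M * evalMatrix s N :=
  Matrix.map_mul (f := (aeval s : ℝ[X] →ₐ[ℝ] ℂ))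

theorem evalMatrix_add (M N : Matrix (Fin a) (Fin b) ℝ[X]) :
    evalMatrix s (M + N) = evalMatrix s M + evalMatrix s N :=
  Matrix.map_add _ (map_add _) _ _

theorem evalMatrix_one : evalMatrix s (1 : Matrix (Fin a) (Fin a) ℝ[X]) = 1 :=
  Matrix.map_one _ (map_zero _) (map_one _)

theorem det_evalMatrix (M : Matrix (Fin a) (Fin a) ℝ[X]) :
    (evalMatrix s M).det = aeval s M.det :=
  ((aeval s : ℝ[X] →ₐ[ℝ] ℂ).map_det M).symm

theorem aeval_comp_neg_X (q : ℝ[X]) : aeval s (q.comp (-X)) = aeval (-s) q := by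
  rw [aeval_comp]; simp

theorem aeval_star (q : ℝ[X]) : aeval (star s) q = star (aeval s q) :=
  aeval_conj q s

theorem evalMatrix_paraTranspose (M : Matrix (Fin a) (Fin b) ℝ[X]) :
    evalMatrix s (paraTranspose M) = (evalMatrix (-s) M)ᵀ := by
  ext1 i j
  simp [evalMatrix_apply, paraTranspose_apply, aeval_comp_neg_X]

theorem star_mul_I (ω : ℝ) : star ((ω : ℂ) * Complex.I) = -(ω * Complex.I) := by
  simp

/-- On the imaginary axis, `M(-s)ᵀ` is the conjugate transpose of `M(s)`. -/
theorem evalMatrix_paraTranspose_axis (ω : ℝ) (M : Matrix (Fin a) (Fin b) ℝ[X]) :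
    evalMatrix (ω * Complex.I) (paraTranspose M) = (evalMatrix (ω * Complex.I) M)ᴴ := by
  ext1 i j
  rw [evalMatrix_paraTranspose, Matrix.transpose_apply, Matrix.conjTranspose_apply,
    evalMatrix_apply, evalMatrix_apply, ← aeval_star, star_mul_I]

theorem continuous_evalMatrix (M : Matrix (Fin a) (Fin b) ℝ[X]) :
    Continuous fun s : ℂ => evalMatrix s M :=
  continuous_matrix fun i j => (M i j).continuous_aeval

end EvalMatrix

/-! ### Hurwitz polynomials -/

section Hurwitz

theorem IsHurwitz.ne_zero {q : ℝ[X]} (h : IsHurwitz q) : q ≠ 0 := by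
  rintro rfl
  simpa using h 0 (by simp)

theorem IsHurwitz.axis_ne_zero {q : ℝ[X]} (h : IsHurwitz q) (ω : ℝ) :
    aeval ((ω : ℂ) * Complex.I) q ≠ 0 := fun h0 => by
  simpa using h _ h0

theorem IsHurwitz.mul {q r : ℝ[X]} (hq : IsHurwitz q) (hr : IsHurwitz r) :
    IsHurwitz (q * r) := fun z hz => by
  rw [map_mul, mul_eq_zero] at hz
  exact hz.elim (hq z) (hr z)

theorem isHurwitz_of_isUnit {q : ℝ[X]} (hq : IsUnit q) : IsHurwitz q := fun z hz =>
  absurd hz (hq.map (aeval z)).ne_zero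

/-- A real polynomial with a complex zero `z` is divisible by the minimal polynomial of `z`, whose
complex zeros all have the same real part. -/
theorem exists_irreducible_dvd_of_aeval_eq_zero {q : ℝ[X]} {z : ℂ}
    (hz : aeval z q = 0) :
    ∃ r : ℝ[X], Irreducible r ∧ r ∣ q ∧ ∀ w : ℂ, aeval w r = 0 → w.re = z.re := by
  have hint : IsIntegral ℝ z := Algebra.IsIntegral.isIntegral z
  refine ⟨minpoly ℝ z, minpoly.irreducible hint, minpoly.dvd ℝ z hz, fun w hw => ?_⟩
  -- `(X - z) (X - conj z)` has real coefficients and vanishes at `z`.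
  have h1 : aeval z (X ^ 2 - C (2 * z.re) * X + C (z.re ^ 2 + z.im ^ 2) : ℝ[X]) = 0 := by
    simp only [map_add, map_sub, map_mul, map_pow, aeval_X, aeval_C]
    apply Complex.ext <;> simp [pow_two] <;> ring
  have h2 := aeval_eq_zero_of_dvd_aeval_eq_zero (minpoly.dvd ℝ z h1) hw
  simp only [map_add, map_sub, map_mul, map_pow, aeval_X, aeval_C] at h2
  have hre := congrArg Complex.re h2
  have him := congrArg Complex.im h2
  simp [pow_two] at hre him
  have h3 : (w.re - z.re) * w.im = 0 := by linarith
  rcases mul_eq_zero.1 h3 with h | h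
  · linarith
  · rw [h] at hre
    nlinarith [sq_nonneg (w.re - z.re), sq_nonneg z.im]

end Hurwitz

/-! ### Degrees and growth at infinity -/

section Degrees

/-- For `deg p ≤ n`, the quotient `p(z) / zⁿ` tends at infinity to the coefficient of order `n`. -/
theorem tendsto_aeval_div_pow {p : ℝ[X]} {n : ℕ} (h : p.natDegree ≤ n) :
    Tendsto (fun z : ℂ => aeval z p / z ^ n) (Bornology.cobounded ℂ)
      (nhds ((p.coeff n : ℝ) : ℂ)) := by
  have h1 : Tendsto (fun z : ℂ => aeval z⁻¹ (reflect n p)) (Bornology.cobounded ℂ)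
      (nhds (aeval 0 (reflect n p))) :=
    ((reflect n p).continuous_aeval.tendsto 0).comp tendsto_inv₀_cobounded
  have h2 : aeval (0 : ℂ) (reflect n p) = ((p.coeff n : ℝ) : ℂ) := by
    rw [← coeff_zero_eq_aeval_zero', coeff_reflect, revAt_le (Nat.zero_le n)]
    simp
  rw [h2] at h1
  refine h1.congr' ?_
  filter_upwards [(Filter.hasBasis_cobounded_norm (E := ℂ)).mem_of_mem (i := 1) trivial] with z hz
  have hz0 : z ≠ 0 := by
    rintro rfl
    simp at hz
    linarith
  let _ := invertibleOfNonzero hz0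
  have h3 := eval₂_reflect_mul_pow (algebraMap ℝ ℂ) z n p h
  rw [invOf_eq_inv] at h3
  rw [aeval_def, aeval_def, ← h3]
  field_simp

theorem tendsto_axis_cobounded :
    Tendsto (fun ω : ℝ => (ω : ℂ) * Complex.I) atTop (Bornology.cobounded ℂ) := by
  rw [← tendsto_norm_atTop_iff_cobounded]
  simpa using tendsto_abs_atTop_atTop

/-- A polynomial dominated by another one far up the imaginary axis has at most its degree. -/
theorem natDegree_le_of_norm_le {p q : ℝ[X]} (C : ℝ)
    (h : ∀ᶠ ω : ℝ in atTop, ‖aeval ((ω : ℂ) * Complex.I) p‖ ≤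
      C * ‖aeval ((ω : ℂ) * Complex.I) q‖) : p.natDegree ≤ q.natDegree := by
  by_contra! hlt
  have h1 := ((tendsto_aeval_div_pow le_rfl (p := p)).comp tendsto_axis_cobounded).norm
  have h2 := ((tendsto_aeval_div_pow hlt.le (p := q)).comp tendsto_axis_cobounded).norm
  have h3 := le_of_tendsto_of_tendsto h1 (h2.const_mul C) (by
    filter_upwards [h] with ω hω
    simp only [Function.comp, norm_div]
    rw [← mul_div_assoc]
    gcongr)
  rw [coeff_eq_zero_of_natDegree_lt hlt] at h3
  have h4 : p.coeff p.natDegree = 0 := by simpa using h3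
  have : p = 0 := by simpa using h4
  simp [this] at hlt

end Degrees

/-! ### Spectral factorization -/

section SpectralFactorization

open scoped ComplexOrder MatrixOrder Matrix.Norms.L2Operator

variable {k : ℕ}

/-- A para-Hermitian polynomial matrix, `Φ(-s)ᵀ = Φ(s)`, whose values on the imaginary axis are
positive definite. -/
structure IsParaPosDef (Φ : Matrix (Fin k) (Fin k) ℝ[X]) : Prop where
  para : paraTranspose Φ = Φ
  posDef : ∀ ω : ℝ, (evalMatrix (ω * Complex.I) Φ).PosDef

theorem IsParaPosDef.axis_det_ne_zero {Φ : Matrix (Fin k) (Fin k) ℝ[X]} (h : IsParaPosDef Φ)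
    (ω : ℝ) : aeval ((ω : ℂ) * Complex.I) Φ.det ≠ 0 := by
  rw [← det_evalMatrix]
  exact (h.posDef ω).det_pos.ne'

theorem IsParaPosDef.det_ne_zero {Φ : Matrix (Fin k) (Fin k) ℝ[X]} (h : IsParaPosDef Φ) :
    Φ.det ≠ 0 := fun h0 => h.axis_det_ne_zero 0 (by simp [h0])

theorem IsParaPosDef.congr {Φ T : Matrix (Fin k) (Fin k) ℝ[X]} (h : IsParaPosDef Φ)
    (hT : ∀ ω : ℝ, aeval ((ω : ℂ) * Complex.I) T.det ≠ 0) :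
    IsParaPosDef (paraTranspose T * Φ * T) where
  para := by
    rw [paraTranspose_mul, paraTranspose_mul, paraTranspose_paraTranspose, h.para,
      Matrix.mul_assoc]
  posDef ω := by
    rw [evalMatrix_mul, evalMatrix_mul, evalMatrix_paraTranspose_axis]
    refine (h.posDef ω).conjTranspose_mul_mul_same ?_
    refine Matrix.mulVec_injective_of_isUnit ?_
    rw [Matrix.isUnit_iff_isUnit_det, det_evalMatrix]
    exact (hT ω).isUnit

/-- Positivity of `T(-s)ᵀ Φ T` forces `det T` to have no zeros on the axis, so that it
descends to `Φ`. -/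
theorem IsParaPosDef.of_congr {Φ T : Matrix (Fin k) (Fin k) ℝ[X]} (hp : paraTranspose Φ = Φ)
    (h : IsParaPosDef (paraTranspose T * Φ * T)) : IsParaPosDef Φ where
  para := hp
  posDef ω := by
    have h1 := h.posDef ω
    have h2 := h1.det_pos.ne'
    rw [evalMatrix_mul, evalMatrix_mul, evalMatrix_paraTranspose_axis] at h1 h2
    rw [Matrix.det_mul] at h2
    refine (Matrix.IsUnit.posDef_star_left_conjugate_iff ?_).1 h1
    rw [Matrix.isUnit_iff_isUnit_det]
    exact (right_ne_zero_of_mul h2).isUnit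

/-- The Cauchy-Schwarz inequality on the imaginary axis bounds the off-diagonal degrees. -/
theorem IsParaPosDef.natDegree_le {Φ : Matrix (Fin k) (Fin k) ℝ[X]} (h : IsParaPosDef Φ)
    (i j : Fin k) :
    2 * (Φ i j).natDegree ≤ (Φ i i).natDegree + (Φ j j).natDegree := by
  have hne : ∀ i, Φ i i ≠ 0 := fun i h0 => by
    have := (h.posDef 0).diag_pos (i := i)
    rw [evalMatrix_apply, h0] at this
    simp at this
  rw [← natDegree_mul (hne i) (hne j), ← natDegree_pow]
  refine natDegree_le_of_norm_le 1 (Eventually.of_forall fun ω => ?_)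
  have h1 := ((h.posDef ω).posSemidef.submatrix ![i, j]).det_nonneg
  have h2 := (h.posDef ω).isHermitian.apply i j
  rw [Matrix.det_fin_two] at h1
  simp only [Matrix.submatrix_apply, Matrix.cons_val_zero, Matrix.cons_val_one] at h1
  rw [← h2, sub_nonneg, evalMatrix_apply, evalMatrix_apply, evalMatrix_apply] at h1
  rw [map_pow, map_mul, one_mul, norm_pow]
  have h3 := CStarAlgebra.norm_le_norm_of_nonneg_of_le (star_mul_self_nonneg _) h1
  rw [evalMatrix_apply, evalMatrix_apply] at h2
  rw [← h2, norm_star, pow_two, ← norm_star, ← norm_mul]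
  rw [norm_mul, norm_star] at h3 ⊢
  exact h3

theorem even_natDegree_of_comp_neg_X {q : ℝ[X]} (h : q.comp (-X) = q) : Even q.natDegree := by
  by_cases h0 : q = 0
  · simp [h0]
  have h1 := comp_neg_X_leadingCoeff_eq q
  rw [h] at h1
  by_contra hodd
  rw [Nat.not_even_iff_odd] at hodd
  rw [hodd.neg_one_pow] at h1
  have : q.leadingCoeff = 0 := by linarith
  exact h0 (by simpa using this)

/-- If `deg Φᵢⱼ ≤ aᵢ + aⱼ` with some positive `aᵢ`, but the determinant is constant, then the matrix
of the coefficients of order `aᵢ + aⱼ` is singular: its determinant is the coefficient of `det Φ`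
of order `2 ∑ aᵢ`. -/
theorem det_leadingCoeff_eq_zero {Φ : Matrix (Fin k) (Fin k) ℝ[X]} (a : Fin k → ℕ)
    (ha : ∀ i j, (Φ i j).natDegree ≤ a i + a j) (hdet : Φ.det.natDegree = 0)
    (hpos : 0 < ∑ i, a i) :
    (Matrix.of fun i j => (Φ i j).coeff (a i + a j)).det = 0 := by
  set L : Matrix (Fin k) (Fin k) ℝ := Matrix.of fun i j => (Φ i j).coeff (a i + a j) with hL
  have h1 : Tendsto (fun z : ℂ => (Matrix.of fun i j => aeval z (Φ i j) / z ^ (a i + a j)).det)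
      (Bornology.cobounded ℂ) (nhds (L.map ((↑) : ℝ → ℂ)).det) := by
    refine ((continuous_id.matrix_det (n := Fin k) (R := ℂ)).tendsto
      (L.map ((↑) : ℝ → ℂ))).comp ?_
    refine tendsto_pi_nhds.2 fun i => tendsto_pi_nhds.2 fun j => ?_
    exact tendsto_aeval_div_pow (ha i j)
  have h2 : ∀ᶠ z : ℂ in Bornology.cobounded ℂ,
      (Matrix.of fun i j => aeval z (Φ i j) / z ^ (a i + a j)).det =
        aeval z Φ.det / z ^ (2 * ∑ i, a i) := by
    filter_upwards [] with z
    have : (Matrix.of fun i j => aeval z (Φ i j) / z ^ (a i + a j)) =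
        Matrix.diagonal (fun i => (z ^ a i)⁻¹) * evalMatrix z Φ *
          Matrix.diagonal (fun i => (z ^ a i)⁻¹) := by
      ext1 i j
      rw [Matrix.mul_diagonal, Matrix.diagonal_mul, Matrix.of_apply, pow_add, evalMatrix_apply,
        div_eq_mul_inv, mul_inv]
      ring
    rw [this, Matrix.det_mul, Matrix.det_mul, Matrix.det_diagonal, det_evalMatrix,
      Finset.prod_inv_distrib, Finset.prod_pow_eq_pow_sum, two_mul, pow_add, div_eq_mul_inv,
      mul_inv]
    ring
  have h3 := tendsto_nhds_unique (h1.congr' h2)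
    (tendsto_aeval_div_pow (p := Φ.det) (n := 2 * ∑ i, a i) (by omega))
  rw [coeff_eq_zero_of_natDegree_lt (by omega)] at h3
  have h4 : (L.map ((↑) : ℝ → ℂ)).det = ((L.det : ℝ) : ℂ) :=
    ((Complex.ofRealHom).map_det L).symm
  rw [h4] at h3
  exact_mod_cast h3

/-- A constant para-positive matrix is real positive semidefinite, and its real square root is
a factor. -/
theorem exists_factor_of_constant {Φ : Matrix (Fin k) (Fin k) ℝ[X]} (h : IsParaPosDef Φ)
    (hc : ∀ i j, (Φ i j).natDegree = 0) :
    ∃ U : Matrix (Fin k) (Fin k) ℝ[X], Φ = paraTranspose U * U := by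
  set A : Matrix (Fin k) (Fin k) ℝ := Φ.map fun q => q.coeff 0 with hA
  have hΦ : Φ = A.map C := by
    ext1 i j
    exact eq_C_of_natDegree_eq_zero (hc i j)
  have hev : ∀ i j, evalMatrix 0 Φ i j = (A i j : ℂ) := fun i j => by
    rw [evalMatrix_apply, hΦ]; simp
  have hpos := (h.posDef 0).posSemidef
  rw [Complex.ofReal_zero, zero_mul] at hpos
  have hpsd : A.PosSemidef := by
    refine Matrix.PosSemidef.of_dotProduct_mulVec_nonneg ?_ fun x => ?_
    · ext1 i j
      have := hpos.isHermitian.apply i j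
      rw [hev, hev] at this
      simpa using this
    · have h1 := hpos.dotProduct_mulVec_nonneg fun i => (x i : ℂ)
      have h2 : star (fun i => (x i : ℂ)) ⬝ᵥ (evalMatrix 0 Φ *ᵥ fun i => (x i : ℂ)) =
          ((star x ⬝ᵥ (A *ᵥ x) : ℝ) : ℂ) := by
        simp [dotProduct, Matrix.mulVec, hev]
      rw [h2] at h1
      exact_mod_cast h1
  obtain ⟨B, hB⟩ := CStarAlgebra.nonneg_iff_eq_star_mul_self.mp hpsd.nonneg
  refine ⟨B.map C, ?_⟩
  ext1 i j
  rw [hΦ, Matrix.map_apply, hB, Matrix.mul_apply, Matrix.mul_apply, map_sum]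
  refine Finset.sum_congr rfl fun l _ => ?_
  simp [paraTranspose_apply, Matrix.star_apply]

theorem det_one_updateCol {R : Type*} [CommRing R] (j : Fin k) (v : Fin k → R) :
    ((1 : Matrix (Fin k) (Fin k) R).updateCol j v).det = v j := by
  rw [← Matrix.cramer_apply, Matrix.cramer_one]
  simp

/-- Spectral factorization for a constant determinant. A kernel vector of the matrix of leading
coefficients gives a unimodular congruence that lowers a diagonal degree. -/
theorem exists_unimodular_factor {Φ : Matrix (Fin k) (Fin k) ℝ[X]} (h : IsParaPosDef Φ)
    (hdet : IsUnit Φ.det) :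
    ∃ U : Matrix (Fin k) (Fin k) ℝ[X], Φ = paraTranspose U * U := by
  induction hn : ∑ i, (Φ i i).natDegree using Nat.strong_induction_on generalizing Φ with
  | _ n ih =>
  have heven : ∀ i, ∃ r, (Φ i i).natDegree = r + r := fun i =>
    even_natDegree_of_comp_neg_X (congrFun (congrFun h.para i) i)
  choose a ha using heven
  have hle : ∀ i j, (Φ i j).natDegree ≤ a i + a j := fun i j => by
    have := h.natDegree_le i j
    rw [ha, ha] at this
    omega
  rcases Nat.eq_zero_or_pos (∑ i, a i) with h0 | hpos
  · refine exists_factor_of_constant h fun i j => ?_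
    rw [Finset.sum_eq_zero_iff] at h0
    have := hle i j
    rw [h0 i (Finset.mem_univ _), h0 j (Finset.mem_univ _)] at this
    omega
  have hL := det_leadingCoeff_eq_zero a hle (natDegree_eq_zero_of_isUnit hdet) hpos
  obtain ⟨c, hc0, hc⟩ := Matrix.exists_mulVec_eq_zero_iff.2 hL
  -- Among the indices in the support of `c`, take one with the largest diagonal degree.
  obtain ⟨j, hj, hmax⟩ := Finset.exists_max_image (Finset.univ.filter fun i => c i ≠ 0) a
    (by
      obtain ⟨i, hi⟩ := Function.ne_iff.1 hc0
      exact ⟨i, by simpa using hi⟩)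
  have hj : c j ≠ 0 := by simpa using hj
  have hmax : ∀ i, c i ≠ 0 → a i ≤ a j := fun i hi => hmax i (by simpa using hi)
  set v : Fin k → ℝ[X] := fun i => C (c i) * X ^ (a j - a i) with hv
  set E : Matrix (Fin k) (Fin k) ℝ[X] := (1 : Matrix (Fin k) (Fin k) ℝ[X]).updateCol j v with hE
  have hEdet : IsUnit E.det := by
    rw [hE, det_one_updateCol, hv]
    simpa using hj.isUnit.map C
  have h' : IsParaPosDef (paraTranspose E * Φ * E) :=
    h.congr fun ω => (hEdet.map (aeval ((ω : ℂ) * Complex.I))).ne_zero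
  -- The new basis vector has a smaller degree, the other ones stay the same.
  have hdiag : ∀ i, i ≠ j → (paraTranspose E * Φ * E) i i = Φ i i := fun i hi => by
    have h1 : ∀ l, E l i = (1 : Matrix (Fin k) (Fin k) ℝ[X]) l i := fun l => by
      rw [hE, Matrix.updateCol_ne hi]
    simp only [Matrix.mul_apply, paraTranspose_apply, h1]
    rw [Finset.sum_eq_single i (by intro l _ hl; simp [Matrix.one_apply_ne hl]) (by simp),
      Finset.sum_eq_single i (by intro l _ hl; simp [Matrix.one_apply_ne hl]) (by simp)]
    simp
  have hjj : ((paraTranspose E * Φ * E) j j).natDegree < (Φ j j).natDegree := by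
    have h1 : ∀ l, E l j = v l := fun l => by rw [hE, Matrix.updateCol_self]
    have h2 : (paraTranspose E * Φ * E) j j = ∑ l, ∑ i, (v i).comp (-X) * Φ i l * v l := by
      simp [Matrix.mul_apply, paraTranspose_apply, h1, Finset.sum_mul]
    have h3 : ∀ i l, (v i).comp (-X) * Φ i l * v l =
        C (c i * (-1) ^ (a j - a i) * c l) * (Φ i l * X ^ ((a j - a i) + (a j - a l))) :=
      fun i l => by
        simp only [hv, mul_comp, C_comp, X_pow_comp, neg_pow (X : ℝ[X]), pow_add, C_mul, C_pow,
          C_neg, C_1]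
        ring
    have hexp : ∀ i l, c i ≠ 0 → c l ≠ 0 →
        a i + a l + ((a j - a i) + (a j - a l)) = a j + a j := fun i l hi hl => by
      have := hmax i hi
      have := hmax l hl
      omega
    have h4 : ((paraTranspose E * Φ * E) j j).natDegree ≤ a j + a j := by
      rw [h2]
      refine natDegree_sum_le_of_forall_le _ _ fun l _ =>
        natDegree_sum_le_of_forall_le _ _ fun i _ => ?_
      rw [h3]
      by_cases hi : c i = 0
      · simp [hi]
      by_cases hl : c l = 0
      · simp [hl]
      refine (natDegree_C_mul_le _ _).trans (natDegree_mul_le.trans ?_)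
      rw [natDegree_X_pow, ← hexp i l hi hl]
      exact Nat.add_le_add_right (hle i l) _
    have h5 : ((paraTranspose E * Φ * E) j j).coeff (a j + a j) = 0 := by
      have h6 : ∀ i l, ((v i).comp (-X) * Φ i l * v l).coeff (a j + a j) =
          c i * (-1) ^ (a j - a i) * ((Φ i l).coeff (a i + a l) * c l) := fun i l => by
        rw [h3, coeff_C_mul]
        by_cases hi : c i = 0
        · simp [hi]
        by_cases hl : c l = 0
        · simp [hl]
        rw [← hexp i l hi hl, coeff_mul_X_pow]
        ring
      rw [h2, Finset.sum_comm]
      simp only [finsetSum_coeff, h6]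
      refine Finset.sum_eq_zero fun i _ => ?_
      rw [← Finset.mul_sum]
      have h7 := congrFun hc i
      simp only [Matrix.mulVec, dotProduct, Matrix.of_apply, Pi.zero_apply] at h7
      rw [h7, mul_zero]
    have h8 : (paraTranspose E * Φ * E) j j ≠ 0 := fun h0 => by
      have := (h'.posDef 0).diag_pos (i := j)
      rw [evalMatrix_apply, h0] at this
      simp at this
    rw [ha]
    refine lt_of_le_of_ne h4 fun heq => h8 ?_
    rw [← leadingCoeff_eq_zero, leadingCoeff, heq, h5]
  have hsum : ∑ i, ((paraTranspose E * Φ * E) i i).natDegree < n := by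
    rw [← hn]
    refine Finset.sum_lt_sum (fun i _ => ?_) ⟨j, Finset.mem_univ _, hjj⟩
    by_cases hi : i = j
    · rw [hi]; exact hjj.le
    · rw [hdiag i hi]
  obtain ⟨U, hU⟩ := ih _ hsum h' (by
    rw [Matrix.det_mul, Matrix.det_mul, det_paraTranspose]
    exact ((hEdet.map (compRingHom (-X : ℝ[X]))).mul hdet).mul hEdet) rfl
  refine ⟨U * E⁻¹, ?_⟩
  have h3 : E * E⁻¹ = 1 := Matrix.mul_nonsing_inv _ hEdet
  have h4 : paraTranspose E⁻¹ * paraTranspose E = 1 := by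
    rw [← paraTranspose_mul, h3, paraTranspose_one]
  calc Φ = (paraTranspose E⁻¹ * paraTranspose E) * Φ * (E * E⁻¹) := by rw [h3, h4]; simp
    _ = paraTranspose E⁻¹ * (paraTranspose E * Φ * E) * E⁻¹ := by simp only [Matrix.mul_assoc]
    _ = _ := by rw [hU, paraTranspose_mul]; simp only [Matrix.mul_assoc]

/-- A factor `q` of the determinant, coprime to `q(-s)`, can be split off symmetrically. After a
unimodular congruence a kernel vector of `Φ` modulo `q` is a basis vector, whose column is then
divisible by `q` and whose row is divisible by `q(-s)`. -/
theorem exists_extraction {Φ : Matrix (Fin k) (Fin k) ℝ[X]} (h : paraTranspose Φ = Φ)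
    {q : ℝ[X]} (hq : Irreducible q) (hqs : IsCoprime q (q.comp (-X))) (hdvd : q ∣ Φ.det) :
    ∃ T Φ' : Matrix (Fin k) (Fin k) ℝ[X], Φ = paraTranspose T * Φ' * T ∧ T.det = q ∧
      paraTranspose Φ' = Φ' := by
  -- A kernel vector of `Φ` modulo `q`, normalized to have an entry `1`.
  obtain ⟨v, w, j, hvj, hv⟩ : ∃ (v w : Fin k → ℝ[X]) (j : Fin k), v j = 1 ∧
      Φ *ᵥ v = q • w := by
    have : Fact (Irreducible q) := ⟨hq⟩
    have h1 : (Φ.map (AdjoinRoot.mk q)).det = 0 := by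
      have := (AdjoinRoot.mk q).map_det Φ
      rw [AdjoinRoot.mk_eq_zero.2 hdvd] at this
      exact this.symm
    obtain ⟨u, hu0, hu⟩ := Matrix.exists_mulVec_eq_zero_iff.2 h1
    obtain ⟨j, hj⟩ := Function.ne_iff.1 hu0
    have hlift : ∀ i, ∃ r : ℝ[X], AdjoinRoot.mk q r = (u j)⁻¹ * u i ∧ (i = j → r = 1) :=
      fun i => by
        by_cases hi : i = j
        · refine ⟨1, ?_, fun _ => rfl⟩
          rw [hi, inv_mul_cancel₀ hj, map_one]
        · obtain ⟨r, hr⟩ := AdjoinRoot.mk_surjective ((u j)⁻¹ * u i)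
          exact ⟨r, hr, fun h => absurd h hi⟩
    choose v hv hvj using hlift
    have h2 : ∀ i, q ∣ (Φ *ᵥ v) i := fun i => by
      rw [← AdjoinRoot.mk_eq_zero]
      have h3 := congrFun hu i
      simp only [Matrix.mulVec, dotProduct, map_sum, map_mul, Matrix.map_apply, hv,
        Pi.zero_apply] at h3 ⊢
      rw [← mul_zero (u j)⁻¹, ← h3, Finset.mul_sum]
      exact Finset.sum_congr rfl fun _ _ => by ring
    choose w hw using h2
    exact ⟨v, w, j, hvj j rfl, funext hw⟩
  set E : Matrix (Fin k) (Fin k) ℝ[X] := (1 : Matrix (Fin k) (Fin k) ℝ[X]).updateCol j v with hE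
  have hEdet : E.det = 1 := by rw [hE, det_one_updateCol, hvj]
  set Ψ := paraTranspose E * Φ * E with hΨ
  have hΨp : paraTranspose Ψ = Ψ := by
    rw [hΨ, paraTranspose_mul, paraTranspose_mul, paraTranspose_paraTranspose, h,
      Matrix.mul_assoc]
  have hcol : ∀ i, q ∣ Ψ i j := fun i => by
    have h1 : Ψ i j = (paraTranspose E *ᵥ (Φ *ᵥ v)) i := by
      have h2 : E.col j = v := by
        ext1 l
        simp [hE]
      rw [Matrix.mulVec_mulVec, ← hΨ] at *
      rw [← h2]
      rfl
    rw [h1, hv, Matrix.mulVec_smul]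
    exact dvd_mul_right _ _
  have hrow : ∀ i, q.comp (-X) ∣ Ψ j i := fun i => by
    obtain ⟨r, hr⟩ := hcol i
    rw [← hΨp, paraTranspose_apply, hr, mul_comp]
    exact dvd_mul_right _ _
  -- Divide column `j` by `q` and row `j` by `q(-s)`.
  set δ : Fin k → ℝ[X] := fun i => if i = j then q else 1 with hδ
  have hdiv : ∀ i l, ∃ r, Ψ i l = (δ i).comp (-X) * r * δ l := fun i l => by
    suffices (δ i).comp (-X) * δ l ∣ Ψ i l by
      obtain ⟨r, hr⟩ := this
      exact ⟨r, by rw [hr]; ring⟩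
    by_cases hi : i = j <;> by_cases hl : l = j
    · subst hi; subst hl
      simpa [hδ] using hqs.symm.mul_dvd (hrow l) (hcol l)
    · subst hi
      simpa [hδ, hl] using hrow l
    · subst hl
      simpa [hδ, hi] using hcol i
    · simp [hδ, hi, hl]
  choose r hr using hdiv
  have hδ0 : ∀ i, δ i ≠ 0 := fun i => by
    rw [hδ]; dsimp only
    split_ifs
    exacts [hq.ne_zero, one_ne_zero]
  have hΨr : Ψ = paraTranspose (Matrix.diagonal δ) * Matrix.of r * Matrix.diagonal δ := by
    have : paraTranspose (Matrix.diagonal δ) = Matrix.diagonal fun i => (δ i).comp (-X) := by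
      rw [paraTranspose, Matrix.diagonal_map (by simp), Matrix.diagonal_transpose]
    ext1 i l
    rw [this, Matrix.mul_diagonal, Matrix.diagonal_mul, hr]
    rfl
  have hEu : IsUnit E.det := hEdet ▸ isUnit_one
  have h3 : E * E⁻¹ = 1 := Matrix.mul_nonsing_inv _ hEu
  have h4 : paraTranspose E⁻¹ * paraTranspose E = 1 := by
    rw [← paraTranspose_mul, h3, paraTranspose_one]
  refine ⟨Matrix.diagonal δ * E⁻¹, Matrix.of r, ?_, ?_, ?_⟩
  · calc Φ = (paraTranspose E⁻¹ * paraTranspose E) * Φ * (E * E⁻¹) := by rw [h3, h4]; simp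
      _ = paraTranspose E⁻¹ * Ψ * E⁻¹ := by rw [hΨ]; simp only [Matrix.mul_assoc]
      _ = _ := by rw [hΨr, paraTranspose_mul]; simp only [Matrix.mul_assoc]
  · rw [Matrix.det_mul, Matrix.det_nonsing_inv, hEdet, Matrix.det_diagonal]
    simp [hδ]
  · ext1 i l
    have h5 := congrFun (congrFun hΨp i) l
    rw [paraTranspose_apply, hr, hr] at h5
    simp only [mul_comp, comp_neg_X_comp_neg_X] at h5
    have h6 : (δ i).comp (-X) ≠ 0 := fun h0 => hδ0 i (comp_neg_X_eq_zero_iff.1 h0)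
    rw [paraTranspose_apply, Matrix.of_apply, Matrix.of_apply]
    refine mul_left_cancel₀ h6 (mul_right_cancel₀ (hδ0 l) ?_)
    rw [← h5]
    ring

/-- Spectral factorization, by splitting off the zeros of the determinant in the left half-plane
one irreducible factor at a time. -/
theorem exists_spectral_factor {Φ : Matrix (Fin k) (Fin k) ℝ[X]} (h : IsParaPosDef Φ) :
    ∃ d : Matrix (Fin k) (Fin k) ℝ[X], Φ = paraTranspose d * d ∧ IsHurwitz d.det := by
  induction hn : Φ.det.natDegree using Nat.strong_induction_on generalizing Φ with
  | _ n ih =>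
  by_cases hu : IsUnit Φ.det
  · obtain ⟨U, hU⟩ := exists_unimodular_factor h hu
    refine ⟨U, hU, isHurwitz_of_isUnit ?_⟩
    rw [hU, Matrix.det_mul] at hu
    exact isUnit_of_mul_isUnit_right hu
  -- The determinant is even without zeros on the axis, so it has a zero in the left half-plane.
  have hdeg : (Φ.det.map (algebraMap ℝ ℂ)).degree ≠ 0 := by
    rw [degree_map]
    exact fun h0 => hu (isUnit_iff_degree_eq_zero.2 h0)
  obtain ⟨z, hz⟩ := IsAlgClosed.exists_root _ hdeg
  have hz : aeval z Φ.det = 0 := by rwa [IsRoot, eval_map_algebraMap] at hz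
  have hz' : aeval (-z) Φ.det = 0 := by
    rw [← aeval_comp_neg_X, ← det_paraTranspose, h.para, hz]
  have hre : z.re ≠ 0 := fun h0 => by
    refine h.axis_det_ne_zero z.im ?_
    have : (z.im : ℂ) * Complex.I = z := by apply Complex.ext <;> simp [h0]
    rw [this, hz]
  obtain ⟨w, hw, hwre⟩ : ∃ w : ℂ, aeval w Φ.det = 0 ∧ w.re < 0 := by
    rcases lt_or_gt_of_ne hre with h1 | h1
    · exact ⟨z, hz, h1⟩
    · exact ⟨-z, hz', by simpa using h1⟩
  obtain ⟨q, hq, hqd, hqr⟩ := exists_irreducible_dvd_of_aeval_eq_zero hw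
  have hqH : IsHurwitz q := fun x hx => by rw [hqr x hx]; exact hwre
  have hcop : IsCoprime q (q.comp (-X)) := by
    rw [hq.coprime_iff_not_dvd]
    intro hd
    -- A complex zero of `q` would be a zero of `q(-s)`.
    obtain ⟨x, hx⟩ := IsAlgClosed.exists_root (q.map (algebraMap ℝ ℂ)) (by
      rw [degree_map]
      exact fun h0 => hq.not_isUnit (isUnit_iff_degree_eq_zero.2 h0))
    rw [IsRoot, eval_map_algebraMap] at hx
    have h1 := aeval_eq_zero_of_dvd_aeval_eq_zero hd hx
    rw [aeval_comp_neg_X] at h1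
    have h2 := hqH _ hx
    have h3 := hqH _ h1
    simp at h3
    linarith
  obtain ⟨T, Φ', hΦ, hT, hpara⟩ := exists_extraction h.para hq hcop hqd
  have h' : IsParaPosDef Φ' := IsParaPosDef.of_congr (T := T) hpara (hΦ ▸ h)
  have hlt : Φ'.det.natDegree < n := by
    have h1 : Φ.det = (q.comp (-X) * q) * Φ'.det := by
      rw [hΦ, Matrix.det_mul, Matrix.det_mul, det_paraTranspose, hT]; ring
    have h2 : (q.comp (-X) * q) ≠ 0 := mul_ne_zero
      (fun h0 => hq.ne_zero (comp_neg_X_eq_zero_iff.1 h0)) hq.ne_zero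
    rw [← hn, h1, natDegree_mul h2 h'.det_ne_zero, natDegree_mul (left_ne_zero_of_mul h2)
      hq.ne_zero]
    have := hq.natDegree_pos
    omega
  obtain ⟨d, hd, hdH⟩ := ih _ hlt h' rfl
  refine ⟨d * T, ?_, ?_⟩
  · rw [hΦ, hd, paraTranspose_mul]
    simp only [Matrix.mul_assoc]
  · rw [Matrix.det_mul, hT]
    exact hdH.mul hqH

end SpectralFactorization

/-! ### The dimension of the cokernel of a polynomial matrix -/

section QuotientDimension

variable {k : ℕ}

theorem finrank_range_mulVecLin {M : Matrix (Fin k) (Fin k) ℝ[X]} (hM : M.det ≠ 0) :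
    Module.finrank ℝ[X] (LinearMap.range M.mulVecLin) =
      Module.finrank ℝ[X] (Fin k → ℝ[X]) :=
  LinearMap.finrank_range_of_inj (Matrix.mulVec_injective_of_det_ne_zero hM)

/-- The Smith coefficients of the column module of `M` multiply to the determinant of `M`. -/
theorem associated_det_prod_smithNormalFormCoeffs {M : Matrix (Fin k) (Fin k) ℝ[X]}
    (hM : M.det ≠ 0) :
    Associated M.det (∏ i, Submodule.smithNormalFormCoeffs (Pi.basisFun ℝ[X] (Fin k))
      (finrank_range_mulVecLin hM) i) := by
  set b := Pi.basisFun ℝ[X] (Fin k)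
  set h := finrank_range_mulVecLin hM
  set a := Submodule.smithNormalFormCoeffs b h
  set b' := Submodule.smithNormalFormTopBasis b h
  set ab := Submodule.smithNormalFormBotBasis b h
  have hab : ∀ i, (ab i : Fin k → ℝ[X]) = a i • b' i :=
    Submodule.smithNormalFormBotBasis_def b h
  set e' := b'.equiv ab (Equiv.refl _) with he'
  set e₁ := LinearEquiv.ofInjective M.mulVecLin (Matrix.mulVec_injective_of_det_ne_zero hM)
  set f' : (Fin k → ℝ[X]) →ₗ[ℝ[X]] (Fin k → ℝ[X]) :=
    (LinearMap.range M.mulVecLin).subtype ∘ₗ e'.toLinearMap with hf'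
  have h1 : LinearMap.det f' = ∏ i, a i := by
    rw [← LinearMap.det_toMatrix b', ← Matrix.det_diagonal]
    congr 1
    ext1 i j
    rw [LinearMap.toMatrix_apply]
    simp [hf', he', hab, Matrix.diagonal_apply, Finsupp.single_apply, eq_comm]
    split_ifs with hij
    · rw [hij]
    · rfl
  rw [← h1, ← LinearMap.det_toLin' M]
  refine LinearMap.associated_det_of_eq_comp (e₁ ≪≫ₗ e'.symm) _ _ fun x => ?_
  simp [hf', e₁]
  rfl

/-- The dimension of `ℝ[s]ᵏ / M ℝ[s]ᵏ` is the degree of `det M`, by the Smith normal form. -/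
theorem finite_and_finrank_quotient_range {M : Matrix (Fin k) (Fin k) ℝ[X]} (hM : M.det ≠ 0) :
    Module.Finite ℝ ((Fin k → ℝ[X]) ⧸ LinearMap.range M.mulVecLin) ∧
    Module.finrank ℝ ((Fin k → ℝ[X]) ⧸ LinearMap.range M.mulVecLin) = M.det.natDegree := by
  set b := Pi.basisFun ℝ[X] (Fin k)
  set h := finrank_range_mulVecLin hM
  have hne := Submodule.smithNormalFormCoeffs_ne_zero b h
  have e := (Submodule.quotientEquivPiSpan _ b h).restrictScalars ℝ
  have hfin : ∀ i, Module.Finite ℝ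
      (ℝ[X] ⧸ Ideal.span {Submodule.smithNormalFormCoeffs b h i}) := fun i =>
    (AdjoinRoot.powerBasis (hne i)).finite
  refine ⟨Module.Finite.equiv e.symm, ?_⟩
  rw [e.finrank_eq, Module.finrank_pi_fintype, natDegree_eq_of_degree_eq
    (degree_eq_degree_of_associated (associated_det_prod_smithNormalFormCoeffs hM)),
    natDegree_prod _ _ fun i _ => hne i]
  exact Finset.sum_congr rfl fun i _ => (AdjoinRoot.powerBasis (hne i)).finrank

end QuotientDimension

/-! ### Resolvents and Markov parameters -/

section Resolvent

open scoped Matrix.Norms.Operator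

variable {n : ℕ}

theorem tendsto_resolvent_matrix (A : Matrix (Fin n) (Fin n) ℂ) :
    Tendsto (fun z : ℂ => (z • (1 : Matrix (Fin n) (Fin n) ℂ) - A)⁻¹) (Bornology.cobounded ℂ)
      (nhds 0) := by
  have h := spectrum.resolvent_tendsto_cobounded (𝕜 := ℂ) A
  refine h.congr fun z => ?_
  rw [resolvent, Matrix.nonsing_inv_eq_ringInverse, Algebra.algebraMap_eq_smul_one]

end Resolvent

section CharMatrix

variable {n : ℕ} (A : Matrix (Fin n) (Fin n) ℝ)

theorem charmatrix_map_ratFunc :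
    A.charmatrix.map (algebraMap ℝ[X] (RatFunc ℝ)) =
      (RatFunc.X : RatFunc ℝ) • (1 : Matrix (Fin n) (Fin n) (RatFunc ℝ)) - A.map RatFunc.C := by
  ext1 i j
  by_cases h : i = j
  · subst h; simp [Matrix.charmatrix_apply_eq, RatFunc.algebraMap_X, RatFunc.algebraMap_C]
  · simp [Matrix.charmatrix_apply_ne _ _ _ h, Matrix.one_apply_ne h, RatFunc.algebraMap_C]

theorem evalMatrix_charmatrix (z : ℂ) :
    evalMatrix z A.charmatrix =
      z • (1 : Matrix (Fin n) (Fin n) ℂ) - A.map ((↑) : ℝ → ℂ) := by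
  ext1 i j
  rw [evalMatrix_apply]
  by_cases h : i = j
  · subst h; simp [Matrix.charmatrix_apply_eq]
  · simp [Matrix.charmatrix_apply_ne _ _ _ h, Matrix.one_apply_ne h]

theorem map_C_map_ratFunc {a b : ℕ} (N : Matrix (Fin a) (Fin b) ℝ) :
    (N.map C).map (algebraMap ℝ[X] (RatFunc ℝ)) = N.map RatFunc.C := by
  ext1 i j
  simp [RatFunc.algebraMap_C]

theorem map_ratFunc_mulVec {a b : ℕ} (N : Matrix (Fin a) (Fin b) ℝ[X]) (v : Fin b → ℝ[X]) :
    (fun i => algebraMap ℝ[X] (RatFunc ℝ) ((N *ᵥ v) i)) =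
      N.map (algebraMap ℝ[X] (RatFunc ℝ)) *ᵥ fun i => algebraMap ℝ[X] (RatFunc ℝ) (v i) := by
  funext i
  simp [Matrix.mulVec, dotProduct]

theorem isUnit_charmatrix_map_ratFunc :
    IsUnit (A.charmatrix.map (algebraMap ℝ[X] (RatFunc ℝ))).det := by
  rw [isUnit_iff_ne_zero]
  have h := (algebraMap ℝ[X] (RatFunc ℝ)).map_det A.charmatrix
  rw [RingHom.mapMatrix_apply] at h
  rw [← h]
  exact (map_ne_zero_iff _ (IsFractionRing.injective ℝ[X] (RatFunc ℝ))).2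
    A.charpoly_monic.ne_zero

/-- A nonzero real polynomial has no zeros far from the origin. -/
theorem eventually_aeval_ne_zero {q : ℝ[X]} (hq : q ≠ 0) :
    ∀ᶠ z : ℂ in Bornology.cobounded ℂ, aeval z q ≠ 0 := by
  have h := (tendsto_aeval_div_pow (le_refl q.natDegree)).eventually_ne
    (show ((q.coeff q.natDegree : ℝ) : ℂ) ≠ 0 by simpa using hq)
  filter_upwards [h] with z hz h0
  simp [h0] at hz

theorem eq_zero_of_tendsto_aeval_zero {t : ℝ[X]}
    (h : Tendsto (fun z : ℂ => aeval z t) (Bornology.cobounded ℂ) (nhds 0)) : t = 0 := by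
  have h1 := tendsto_aeval_div_pow (le_refl t.natDegree)
  have h2 : Tendsto (fun z : ℂ => aeval z t / z ^ t.natDegree) (Bornology.cobounded ℂ)
      (nhds 0) := by
    refine squeeze_zero_norm' ?_ (tendsto_zero_iff_norm_tendsto_zero.1 h)
    filter_upwards [(Filter.hasBasis_cobounded_norm (E := ℂ)).mem_of_mem (i := 1) trivial]
      with z hz
    rw [norm_div, norm_pow]
    exact div_le_self (norm_nonneg _) (one_le_pow₀ hz)
  have h3 := tendsto_nhds_unique h1 h2
  simpa using h3

/-- If the strictly proper vector `C (s I - A)⁻¹ x` is polynomial, then it is zero, and so is its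
coefficient `C x` of order `s⁻¹`. -/
theorem mulVec_eq_zero_of_resolvent_polynomial {p : ℕ} (C' : Matrix (Fin p) (Fin n) ℝ)
    (x : Fin n → ℝ) (y : Fin n → RatFunc ℝ) (t : Fin p → ℝ[X])
    (hy : A.charmatrix.map (algebraMap ℝ[X] (RatFunc ℝ)) *ᵥ y = fun i => RatFunc.C (x i))
    (ht : C'.map RatFunc.C *ᵥ y = fun i => algebraMap ℝ[X] (RatFunc ℝ) (t i)) :
    C' *ᵥ x = 0 := by
  have hinj := IsFractionRing.injective ℝ[X] (RatFunc ℝ)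
  -- Clearing denominators gives a polynomial identity, which can be evaluated.
  have h1 : A.charpoly • t = C'.map C *ᵥ (A.charmatrix.adjugate *ᵥ fun i => C (x i)) := by
    have h2 : algebraMap ℝ[X] (RatFunc ℝ) A.charpoly • y =
        A.charmatrix.adjugate.map (algebraMap ℝ[X] (RatFunc ℝ)) *ᵥ fun i => RatFunc.C (x i) := by
      have h3 := (algebraMap ℝ[X] (RatFunc ℝ)).map_adjugate A.charmatrix
      have h4 := (algebraMap ℝ[X] (RatFunc ℝ)).map_det A.charmatrix
      simp only [RingHom.mapMatrix_apply] at h3 h4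
      rw [← hy, Matrix.mulVec_mulVec, h3, Matrix.adjugate_mul, Matrix.charpoly, h4,
        Matrix.smul_mulVec, Matrix.one_mulVec]
    have h5 := congrArg (fun v => C'.map RatFunc.C *ᵥ v) h2
    simp only [Matrix.mulVec_smul, ht] at h5
    funext i
    apply hinj
    have h6 := congrFun h5 i
    simp only [Pi.smul_apply, smul_eq_mul, map_mul] at h6 ⊢
    rw [h6]
    simp [Matrix.mulVec, dotProduct, RatFunc.algebraMap_C]
  set r : ℂ → Matrix (Fin n) (Fin n) ℂ := fun z => (z • 1 - A.map ((↑) : ℝ → ℂ))⁻¹ with hr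
  have hr0 : Tendsto r (Bornology.cobounded ℂ) (nhds 0) := tendsto_resolvent_matrix _
  set Cc := C'.map ((↑) : ℝ → ℂ)
  set xc : Fin n → ℂ := fun i => (x i : ℂ) with hxc
  have hdet : ∀ᶠ z : ℂ in Bornology.cobounded ℂ, aeval z A.charpoly ≠ 0 :=
    eventually_aeval_ne_zero A.charpoly_monic.ne_zero
  have h7 : ∀ᶠ z : ℂ in Bornology.cobounded ℂ, (fun i => aeval z (t i)) = Cc *ᵥ (r z *ᵥ xc) := by
    filter_upwards [hdet] with z hz
    have h8 : aeval z A.charpoly • r z = A.charmatrix.adjugate.map (aeval z) := by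
      have h9 := (aeval z : ℝ[X] →ₐ[ℝ] ℂ).map_adjugate A.charmatrix
      simp only [AlgHom.mapMatrix_apply] at h9
      rw [h9]
      have h10 := evalMatrix_charmatrix A z
      rw [hr]
      dsimp only
      rw [← h10, Matrix.inv_def, det_evalMatrix, ← Matrix.charpoly, smul_smul,
        Ring.mul_inverse_cancel _ hz.isUnit, one_smul]
      rfl
    have h11 : aeval z A.charpoly • (fun i => aeval z (t i)) =
        aeval z A.charpoly • (Cc *ᵥ (r z *ᵥ xc)) := by
      rw [← Matrix.mulVec_smul, ← Matrix.smul_mulVec, h8]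
      funext i
      have h12 := congrArg (aeval z) (congrFun h1 i)
      simp only [Pi.smul_apply, smul_eq_mul, map_mul] at h12 ⊢
      rw [h12]
      simp [Matrix.mulVec, dotProduct, Cc, xc]
    exact smul_right_injective _ hz h11
  have hlim : ∀ N : Matrix (Fin p) (Fin n) ℂ,
      Tendsto (fun z => N *ᵥ (r z *ᵥ xc)) (Bornology.cobounded ℂ) (nhds 0) := fun N => by
    have hc : Continuous fun M : Matrix (Fin n) (Fin n) ℂ => N *ᵥ (M *ᵥ xc) := by fun_prop
    have := (hc.tendsto 0).comp hr0
    simpa [Function.comp_def] using this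
  have ht0 : ∀ i, t i = 0 := fun i => by
    refine eq_zero_of_tendsto_aeval_zero ?_
    have := (tendsto_pi_nhds.1 ((hlim Cc).congr' (h7.mono fun z hz => hz.symm))) i
    simpa using this
  have h13 : Tendsto (fun z => Cc *ᵥ xc + (Cc * A.map ((↑) : ℝ → ℂ)) *ᵥ (r z *ᵥ xc))
      (Bornology.cobounded ℂ) (nhds (Cc *ᵥ xc + 0)) := (hlim _).const_add _
  have h14 : ∀ᶠ z : ℂ in Bornology.cobounded ℂ,
      Cc *ᵥ xc + (Cc * A.map ((↑) : ℝ → ℂ)) *ᵥ (r z *ᵥ xc) = 0 := by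
    filter_upwards [h7, hdet] with z hz hz'
    have h15 : Cc *ᵥ (r z *ᵥ xc) = 0 := by
      rw [← hz]; funext i; simp [ht0]
    have h16 : (z • 1 - A.map ((↑) : ℝ → ℂ)) * r z = 1 := by
      refine Matrix.mul_nonsing_inv _ ?_
      rw [← evalMatrix_charmatrix, det_evalMatrix]
      exact hz'.isUnit
    have h17 : xc + A.map ((↑) : ℝ → ℂ) *ᵥ (r z *ᵥ xc) = z • (r z *ᵥ xc) := by
      have := congrArg (fun N => N *ᵥ xc) h16
      simp only [Matrix.sub_mul, Matrix.smul_mul, Matrix.one_mul, Matrix.sub_mulVec,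
        Matrix.one_mulVec, Matrix.smul_mulVec] at this
      rw [Matrix.mulVec_mulVec]
      exact (sub_eq_iff_eq_add.1 this).symm
    rw [← Matrix.mulVec_mulVec, ← Matrix.mulVec_add, h17, Matrix.mulVec_smul, h15, smul_zero]
  have h18 := tendsto_nhds_unique (tendsto_const_nhds.congr' (h14.mono fun z hz => hz.symm)) h13
  funext i
  have h19 := congrFun h18 i
  simp only [add_zero, Pi.zero_apply, Matrix.mulVec, dotProduct, Cc, xc, Matrix.map_apply] at h19 ⊢
  exact_mod_cast h19.symm

/-- Polynomial division of `f(s) I` by `s I - A`, for two matrices at a time: the quotients give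
the same values `C Q B` when the Markov parameters `C Aʲ B` coincide. -/
theorem exists_charmatrix_division {n' k p : ℕ} (A' : Matrix (Fin n') (Fin n') ℝ)
    (B : Matrix (Fin n) (Fin k) ℝ) (C₁ : Matrix (Fin p) (Fin n) ℝ)
    (B' : Matrix (Fin n') (Fin k) ℝ) (C₂ : Matrix (Fin p) (Fin n') ℝ)
    (h : ∀ j, C₁ * A ^ j * B = C₂ * A' ^ j * B') (f : ℝ[X]) :
    ∃ (Q : Matrix (Fin n) (Fin n) ℝ[X]) (Q' : Matrix (Fin n') (Fin n') ℝ[X]),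
      f • (1 : Matrix (Fin n) (Fin n) ℝ[X]) = A.charmatrix * Q + (aeval A f).map C ∧
      f • (1 : Matrix (Fin n') (Fin n') ℝ[X]) = A'.charmatrix * Q' + (aeval A' f).map C ∧
      C₁.map C * Q * B.map C = C₂.map C * Q' * B'.map C := by
  induction f using Polynomial.induction_on with
  | C c =>
    refine ⟨0, 0, ?_, ?_, by simp⟩
    · ext1 i j
      by_cases hij : i = j <;> simp [Matrix.algebraMap_matrix_apply, hij]
    · ext1 i j
      by_cases hij : i = j <;> simp [Matrix.algebraMap_matrix_apply, hij]
  | add f g hf hg =>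
    obtain ⟨Q, Q', h1, h2, h3⟩ := hf
    obtain ⟨R, R', h4, h5, h6⟩ := hg
    refine ⟨Q + R, Q' + R', ?_, ?_, ?_⟩
    · rw [add_smul, h1, h4, map_add, Matrix.map_add _ (map_add C), Matrix.mul_add]
      abel
    · rw [add_smul, h2, h5, map_add, Matrix.map_add _ (map_add C), Matrix.mul_add]
      abel
    · simp only [Matrix.mul_add, Matrix.add_mul, h3, h6]
  | monomial m c hm =>
    obtain ⟨Q, Q', h1, h2, h3⟩ := hm
    -- `s f(s) = s (f(s) - f(A)) + (s I - A) f(A) + A f(A)`.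
    have key : ∀ {l : ℕ} (A : Matrix (Fin l) (Fin l) ℝ) (Q : Matrix (Fin l) (Fin l) ℝ[X]),
        (C c * X ^ m) • (1 : Matrix (Fin l) (Fin l) ℝ[X]) =
          A.charmatrix * Q + (aeval A (C c * X ^ m)).map C →
        (C c * X ^ (m + 1)) • (1 : Matrix (Fin l) (Fin l) ℝ[X]) =
          A.charmatrix * ((X : ℝ[X]) • Q + (aeval A (C c * X ^ m)).map C) +
            (aeval A (C c * X ^ (m + 1))).map C := by
      intro l A Q hQ
      have h4 : A.charmatrix = (X : ℝ[X]) • (1 : Matrix (Fin l) (Fin l) ℝ[X]) - A.map C := by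
        rw [Matrix.charmatrix, Matrix.scalar_apply, Matrix.smul_one_eq_diagonal]
        rfl
      have h5 : (aeval A (C c * X ^ (m + 1))).map C =
          A.map C * (aeval A (C c * X ^ m)).map C := by
        rw [← Matrix.map_mul]
        congr 1
        rw [pow_succ', ← mul_assoc, mul_comm (C c), mul_assoc, map_mul, aeval_X]
      have h6 : (C c * X ^ (m + 1)) • (1 : Matrix (Fin l) (Fin l) ℝ[X]) =
          (X : ℝ[X]) • ((C c * X ^ m) • (1 : Matrix (Fin l) (Fin l) ℝ[X])) := by
        rw [smul_smul]; congr 1; ring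
      rw [h5, h6, hQ, Matrix.mul_add, smul_add, Matrix.mul_smul, add_assoc]
      congr 1
      rw [h4, Matrix.sub_mul, Matrix.smul_mul, Matrix.one_mul, sub_add_cancel]
    refine ⟨_, _, key A Q h1, key A' Q' h2, ?_⟩
    have h7 : C₁.map C * (aeval A (C c * X ^ m)).map C * B.map C =
        C₂.map C * (aeval A' (C c * X ^ m)).map C * B'.map C := by
      simp only [← Matrix.map_mul]
      congr 1
      simp only [map_mul, map_pow, aeval_X, aeval_C, Algebra.algebraMap_eq_smul_one,
        Matrix.smul_mul, Matrix.mul_smul, Matrix.one_mul, h m]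
    simp only [Matrix.mul_add, Matrix.add_mul, Matrix.mul_smul, Matrix.smul_mul, h3, h7]

end CharMatrix

namespace LTISystem

variable {k p : ℕ}

theorem transferFunction_eq (S : LTISystem k p) :
    S.transferFunction = S.C.map RatFunc.C *
      (S.A.charmatrix.map (algebraMap ℝ[X] (RatFunc ℝ)))⁻¹ * S.B.map RatFunc.C +
        S.D.map RatFunc.C := by
  rw [charmatrix_map_ratFunc]; rfl

/-- The transfer function is determined by the Markov parameters. -/
theorem transferFunction_eq_of_markov (S T : LTISystem k p) (hD : S.D = T.D)
    (h : ∀ j, S.C * S.A ^ j * S.B = T.C * T.A ^ j * T.B) :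
    S.transferFunction = T.transferFunction := by
  set f := S.A.charpoly * T.A.charpoly with hf
  have hf0 : algebraMap ℝ[X] (RatFunc ℝ) f ≠ 0 :=
    (map_ne_zero_iff _ (IsFractionRing.injective ℝ[X] (RatFunc ℝ))).2
      (mul_ne_zero S.A.charpoly_monic.ne_zero T.A.charpoly_monic.ne_zero)
  obtain ⟨Q, Q', h1, h2, h3⟩ := exists_charmatrix_division S.A T.A S.B S.C T.B T.C h f
  have hS : aeval S.A f = 0 := by rw [hf, map_mul, Matrix.aeval_self_charpoly, zero_mul]
  have hT : aeval T.A f = 0 := by rw [hf, map_mul, Matrix.aeval_self_charpoly, mul_zero]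
  rw [hS, Matrix.map_zero _ (map_zero _), add_zero] at h1
  rw [hT, Matrix.map_zero _ (map_zero _), add_zero] at h2
  have key : ∀ {l : ℕ} (A : Matrix (Fin l) (Fin l) ℝ) (Q : Matrix (Fin l) (Fin l) ℝ[X])
      (B : Matrix (Fin l) (Fin k) ℝ) (C' : Matrix (Fin p) (Fin l) ℝ),
      f • (1 : Matrix (Fin l) (Fin l) ℝ[X]) = A.charmatrix * Q →
      C'.map RatFunc.C * (A.charmatrix.map (algebraMap ℝ[X] (RatFunc ℝ)))⁻¹ * B.map RatFunc.C =
        (algebraMap ℝ[X] (RatFunc ℝ) f)⁻¹ •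
          (C'.map Polynomial.C * Q * B.map Polynomial.C).map
            (algebraMap ℝ[X] (RatFunc ℝ)) := by
    intro l A Q B C' hQ
    have h4 := congrArg (fun N => N.map (algebraMap ℝ[X] (RatFunc ℝ))) hQ
    simp only [Matrix.map_mul] at h4
    have h5 : (A.charmatrix.map (algebraMap ℝ[X] (RatFunc ℝ)))⁻¹ =
        (algebraMap ℝ[X] (RatFunc ℝ) f)⁻¹ • Q.map (algebraMap ℝ[X] (RatFunc ℝ)) := by
      refine Matrix.inv_eq_right_inv ?_
      rw [Matrix.mul_smul, ← h4]
      ext1 i j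
      rcases eq_or_ne i j with rfl | hij
      · simp [hf0]
      · simp [hij]
    rw [h5, ← map_C_map_ratFunc, ← map_C_map_ratFunc, Matrix.map_mul, Matrix.map_mul,
      Matrix.mul_smul, Matrix.smul_mul]
  rw [transferFunction_eq, transferFunction_eq, key _ Q _ _ h1, key _ Q' _ _ h2, h3, hD]

/-- The state reached from the origin by the polynomial input `u`: the `ℝ[s]`-linear extension of
`eᵢ ↦ B eᵢ`, where `s` acts on the state space as `A`. -/
noncomputable def reach (S : LTISystem k p) : (Fin k → ℝ[X]) →ₗ[ℝ] (Fin S.order → ℝ) :=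
  ∑ i, (LinearMap.applyₗ (S.B.col i) ∘ₗ
    (Matrix.toLin' : Matrix (Fin S.order) (Fin S.order) ℝ ≃ₗ[ℝ] _).toLinearMap ∘ₗ
      (aeval S.A : ℝ[X] →ₐ[ℝ] _).toLinearMap ∘ₗ LinearMap.proj i)

theorem reach_apply (S : LTISystem k p) (u : Fin k → ℝ[X]) :
    S.reach u = ∑ i, aeval S.A (u i) *ᵥ S.B.col i := by
  simp [reach]

theorem reach_X_pow_smul_single (S : LTISystem k p) (j : ℕ) (i : Fin k) :
    S.reach ((X : ℝ[X]) ^ j • Pi.single i 1) = (S.A ^ j * S.B).col i := by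
  rw [reach_apply, Finset.sum_eq_single i (by intro l _ hl; simp [hl]) (by simp)]
  simp
  rfl

/-- The input-to-state equation for the polynomial input `u`. -/
theorem exists_state_division (S : LTISystem k p) (u : Fin k → ℝ[X]) :
    ∃ y : Fin S.order → ℝ[X],
      S.B.map Polynomial.C *ᵥ u =
        S.A.charmatrix *ᵥ y + fun i => Polynomial.C (S.reach u i) := by
  have h := fun i => exists_charmatrix_division S.A S.A S.B S.C S.B S.C (fun _ => rfl) (u i)
  choose Q _ hQ _ _ using h
  refine ⟨∑ i, Q i *ᵥ fun l => Polynomial.C (S.B l i), ?_⟩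
  rw [Matrix.mulVec_sum, reach_apply]
  have h1 : S.B.map Polynomial.C *ᵥ u = ∑ i, (u i • (1 : Matrix _ _ ℝ[X])) *ᵥ
      fun l => Polynomial.C (S.B l i) := by
    funext l
    simp [Matrix.mulVec, dotProduct, Matrix.one_apply, mul_comm]
  have h2 : (fun l => Polynomial.C ((∑ i, aeval S.A (u i) *ᵥ S.B.col i) l)) =
      ∑ i, (aeval S.A (u i)).map Polynomial.C *ᵥ fun l => Polynomial.C (S.B l i) := by
    funext l
    simp [Matrix.mulVec, dotProduct]
  rw [h1, h2, ← Finset.sum_add_distrib]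
  refine Finset.sum_congr rfl fun i _ => ?_
  rw [hQ i, Matrix.add_mulVec, Matrix.mulVec_mulVec]

end LTISystem

/-! ### Coprime fractions and the McMillan degree -/

section McMillanDegree

variable {k p : ℕ}

theorem isUnit_det_map_ratFunc {M : Matrix (Fin k) (Fin k) ℝ[X]} (hM : M.det ≠ 0) :
    IsUnit (M.map (algebraMap ℝ[X] (RatFunc ℝ))).det := by
  have h := (algebraMap ℝ[X] (RatFunc ℝ)).map_det M
  rw [RingHom.mapMatrix_apply] at h
  rw [← h, isUnit_iff_ne_zero]
  exact (map_ne_zero_iff _ (IsFractionRing.injective ℝ[X] (RatFunc ℝ))).2 hM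

theorem map_ratFunc_injective {a b : ℕ} :
    Function.Injective fun N : Matrix (Fin a) (Fin b) ℝ[X] =>
      N.map (algebraMap ℝ[X] (RatFunc ℝ)) :=
  Matrix.map_injective (IsFractionRing.injective ℝ[X] (RatFunc ℝ))

theorem IsRightCoprimeFraction.mul_eq {P : Matrix (Fin p) (Fin k) (RatFunc ℝ)}
    {N : Matrix (Fin p) (Fin k) ℝ[X]} {M : Matrix (Fin k) (Fin k) ℝ[X]}
    (h : IsRightCoprimeFraction P N M) :
    P * M.map (algebraMap ℝ[X] (RatFunc ℝ)) = N.map (algebraMap ℝ[X] (RatFunc ℝ)) := by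
  rw [h.eq_mul_inv, Matrix.mul_assoc,
    Matrix.nonsing_inv_mul _ (isUnit_det_map_ratFunc h.det_ne_zero), Matrix.mul_one]

/-- The polynomial inputs with a polynomial output are the multiples of the denominator. -/
theorem IsRightCoprimeFraction.exists_mul_of_polynomial
    {P : Matrix (Fin p) (Fin k) (RatFunc ℝ)}
    {N : Matrix (Fin p) (Fin k) ℝ[X]} {M : Matrix (Fin k) (Fin k) ℝ[X]}
    (h : IsRightCoprimeFraction P N M) {l : ℕ} (u : Matrix (Fin k) (Fin l) ℝ[X])
    (w : Matrix (Fin p) (Fin l) ℝ[X])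
    (huw : P * u.map (algebraMap ℝ[X] (RatFunc ℝ)) = w.map (algebraMap ℝ[X] (RatFunc ℝ))) :
    ∃ v : Matrix (Fin k) (Fin l) ℝ[X], u = M * v ∧ w = N * v := by
  obtain ⟨U, V, hUV⟩ := h.coprime
  have hu := isUnit_det_map_ratFunc h.det_ne_zero
  have h1 := congrArg (fun N => N.map (algebraMap ℝ[X] (RatFunc ℝ))) hUV
  simp only [Matrix.map_add _ (map_add (algebraMap ℝ[X] (RatFunc ℝ))), Matrix.map_mul,
    Matrix.map_one _ (map_zero (algebraMap ℝ[X] (RatFunc ℝ))) (map_one _)] at h1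
  rw [← h.mul_eq, ← Matrix.mul_assoc, ← Matrix.add_mul] at h1
  have h2 := mul_eq_one_comm.1 h1
  have h3 : u = M * (U * u + V * w) := by
    apply map_ratFunc_injective
    simp only [Matrix.map_add _ (map_add (algebraMap ℝ[X] (RatFunc ℝ))), Matrix.map_mul]
    rw [← huw, ← Matrix.mul_assoc (V.map _), ← Matrix.add_mul, ← Matrix.mul_assoc, h2,
      Matrix.one_mul]
  refine ⟨_, h3, ?_⟩
  apply map_ratFunc_injective
  dsimp only
  rw [Matrix.map_mul, ← h.mul_eq, Matrix.mul_assoc, ← Matrix.map_mul, ← h3, huw]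

/-- Two right-coprime fractions of one transfer function differ by a unimodular factor. -/
theorem IsRightCoprimeFraction.exists_unimodular {P : Matrix (Fin p) (Fin k) (RatFunc ℝ)}
    {N N' : Matrix (Fin p) (Fin k) ℝ[X]} {M M' : Matrix (Fin k) (Fin k) ℝ[X]}
    (h : IsRightCoprimeFraction P N M) (h' : IsRightCoprimeFraction P N' M') :
    ∃ W : Matrix (Fin k) (Fin k) ℝ[X], IsUnit W.det ∧ M' = M * W ∧ N' = N * W := by
  obtain ⟨W, hM, hN⟩ := h.exists_mul_of_polynomial M' N' h'.mul_eq
  obtain ⟨W', hM', -⟩ := h'.exists_mul_of_polynomial M N h.mul_eq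
  refine ⟨W, ?_, hM, hN⟩
  have h1 : M.det * (W.det * W'.det) = M.det * 1 := by
    rw [← Matrix.det_mul, ← Matrix.det_mul, ← Matrix.mul_assoc, ← hM, ← hM', mul_one]
  exact IsUnit.of_mul_eq_one _ (mul_left_cancel₀ h.det_ne_zero h1)

namespace LTISystem

/-- Applied to a polynomial input `u`, the transfer function gives a polynomial vector plus the
strictly proper vector `C (s I - A)⁻¹ x`, where `x` is the state reached by `u`. -/
theorem transferFunction_mulVec (S : LTISystem k p) (u : Fin k → ℝ[X]) :
    ∃ (y : Fin S.order → ℝ[X]) (z : Fin S.order → RatFunc ℝ),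
      S.A.charmatrix.map (algebraMap ℝ[X] (RatFunc ℝ)) *ᵥ z =
        (fun i => RatFunc.C (S.reach u i)) ∧
      S.transferFunction *ᵥ (fun i => algebraMap ℝ[X] (RatFunc ℝ) (u i)) =
        (fun i => algebraMap ℝ[X] (RatFunc ℝ) ((S.C.map Polynomial.C *ᵥ y +
          S.D.map Polynomial.C *ᵥ u) i)) + S.C.map RatFunc.C *ᵥ z := by
  obtain ⟨y, hy⟩ := S.exists_state_division u
  have hu := isUnit_charmatrix_map_ratFunc S.A
  set K := S.A.charmatrix.map (algebraMap ℝ[X] (RatFunc ℝ)) with hK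
  set x : Fin S.order → RatFunc ℝ := fun i => RatFunc.C (S.reach u i) with hx
  have h1 : S.B.map RatFunc.C *ᵥ (fun i => algebraMap ℝ[X] (RatFunc ℝ) (u i)) =
      K *ᵥ (fun i => algebraMap ℝ[X] (RatFunc ℝ) (y i)) + x := by
    rw [← map_C_map_ratFunc, ← map_ratFunc_mulVec, hy, hK, ← map_ratFunc_mulVec]
    funext i
    simp [hx, RatFunc.algebraMap_C]
  refine ⟨y, K⁻¹ *ᵥ x, ?_, ?_⟩
  · rw [Matrix.mulVec_mulVec, Matrix.mul_nonsing_inv _ hu, Matrix.one_mulVec]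
  · have h2 : (fun i => algebraMap ℝ[X] (RatFunc ℝ) ((S.C.map Polynomial.C *ᵥ y +
          S.D.map Polynomial.C *ᵥ u) i)) =
        S.C.map RatFunc.C *ᵥ (fun i => algebraMap ℝ[X] (RatFunc ℝ) (y i)) +
        S.D.map RatFunc.C *ᵥ (fun i => algebraMap ℝ[X] (RatFunc ℝ) (u i)) := by
      rw [← map_C_map_ratFunc, ← map_C_map_ratFunc, ← map_ratFunc_mulVec, ← map_ratFunc_mulVec]
      funext i
      simp
    rw [h2, transferFunction_eq, Matrix.add_mulVec, ← Matrix.mulVec_mulVec, h1,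
      ← Matrix.mulVec_mulVec, Matrix.mulVec_add, Matrix.mulVec_mulVec,
      Matrix.nonsing_inv_mul _ hu, Matrix.one_mulVec, Matrix.mulVec_add]
    abel

variable {S : LTISystem k p} {N : Matrix (Fin p) (Fin k) ℝ[X]}
  {M : Matrix (Fin k) (Fin k) ℝ[X]}

/-- The inputs that steer the system back to the origin are multiples of the denominator. -/
theorem ker_reach_le (h : IsRightCoprimeFraction S.transferFunction N M) :
    LinearMap.ker S.reach ≤ (LinearMap.range M.mulVecLin).restrictScalars ℝ := by
  intro u hu
  obtain ⟨y, z, hz, hP⟩ := S.transferFunction_mulVec u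
  have hz0 : z = 0 := by
    have h1 := congrArg
      (fun v => (S.A.charmatrix.map (algebraMap ℝ[X] (RatFunc ℝ)))⁻¹ *ᵥ v) hz
    simp only [Matrix.mulVec_mulVec,
      Matrix.nonsing_inv_mul _ (isUnit_charmatrix_map_ratFunc S.A), Matrix.one_mulVec] at h1
    rw [h1, LinearMap.mem_ker.1 hu]
    simp only [Pi.zero_apply, map_zero]
    exact Matrix.mulVec_zero _
  rw [hz0, Matrix.mulVec_zero, add_zero] at hP
  obtain ⟨v, hv, -⟩ := h.exists_mul_of_polynomial (Matrix.replicateCol (Fin 1) u)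
    (Matrix.replicateCol (Fin 1) (S.C.map Polynomial.C *ᵥ y + S.D.map Polynomial.C *ᵥ u)) (by
      ext1 i j
      exact congrFun hP i)
  refine ⟨v.col 0, ?_⟩
  funext i
  exact (congrFun (congrFun hv i) 0).symm

/-- Multiples of the denominator reach unobservable states only. -/
theorem output_reach_eq_zero (h : IsRightCoprimeFraction S.transferFunction N M)
    (v : Fin k → ℝ[X]) : S.C *ᵥ S.reach (M *ᵥ v) = 0 := by
  obtain ⟨y, z, hz, hP⟩ := S.transferFunction_mulVec (M *ᵥ v)
  rw [map_ratFunc_mulVec, Matrix.mulVec_mulVec, h.mul_eq, ← map_ratFunc_mulVec] at hP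
  refine mulVec_eq_zero_of_resolvent_polynomial S.A S.C _ z
    (N *ᵥ v - (S.C.map Polynomial.C *ᵥ y + S.D.map Polynomial.C *ᵥ (M *ᵥ v))) hz ?_
  rw [← sub_eq_iff_eq_add'] at hP
  rw [← hP]
  funext i
  simp

/-- The inputs modulo the kernel of `reach` embed into the state space, and `ℝ[s]ᵏ / M ℝ[s]ᵏ` is a
quotient of them. -/
theorem natDegree_det_le_order (h : IsRightCoprimeFraction S.transferFunction N M) :
    M.det.natDegree ≤ S.order := by
  obtain ⟨hf, hr⟩ := finite_and_finrank_quotient_range h.det_ne_zero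
  rw [← hr]
  set R := (LinearMap.range M.mulVecLin).restrictScalars ℝ with hR
  have e := Submodule.Quotient.restrictScalarsEquiv ℝ (LinearMap.range M.mulVecLin)
  have h1 : Function.Surjective (Submodule.factor (ker_reach_le h)) :=
    Submodule.factor_surjective _
  have h2 : Module.Finite ℝ ((Fin k → ℝ[X]) ⧸ LinearMap.ker S.reach) :=
    Module.Finite.equiv S.reach.quotKerEquivRange.symm
  calc Module.finrank ℝ ((Fin k → ℝ[X]) ⧸ LinearMap.range M.mulVecLin)
      = Module.finrank ℝ ((Fin k → ℝ[X]) ⧸ R) := e.finrank_eq.symm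
    _ ≤ Module.finrank ℝ ((Fin k → ℝ[X]) ⧸ LinearMap.ker S.reach) :=
        LinearMap.finrank_le_finrank_of_surjective h1
    _ = Module.finrank ℝ (LinearMap.range S.reach) := S.reach.quotKerEquivRange.finrank_eq
    _ ≤ S.order := by
        simpa using Submodule.finrank_le (LinearMap.range S.reach)

/-- The quotient of the polynomial inputs by the multiples of the denominator is the state space
of a realization. -/
theorem exists_realization (h : IsRightCoprimeFraction S.transferFunction N M) :
    ∃ T : LTISystem k p, T.order = M.det.natDegree ∧
      T.transferFunction = S.transferFunction := by
  obtain ⟨hf, hr⟩ := finite_and_finrank_quotient_range h.det_ne_zero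
  set R := LinearMap.range M.mulVecLin with hR
  let b := Module.finBasis ℝ ((Fin k → ℝ[X]) ⧸ R)
  let α : Module.End ℝ ((Fin k → ℝ[X]) ⧸ R) :=
    Algebra.lsmul ℝ ℝ ((Fin k → ℝ[X]) ⧸ R) (X : ℝ[X])
  let β : (Fin k → ℝ) →ₗ[ℝ] (Fin k → ℝ[X]) ⧸ R :=
    (R.mkQ.restrictScalars ℝ) ∘ₗ LinearMap.pi fun i =>
      (Polynomial.CAlgHom (A := ℝ) (R := ℝ)).toLinearMap ∘ₗ LinearMap.proj i
  let γ : ((Fin k → ℝ[X]) ⧸ R) →ₗ[ℝ] (Fin p → ℝ) :=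
    (R.restrictScalars ℝ).liftQ (S.C.mulVecLin ∘ₗ S.reach) (by
      rintro _ ⟨v, rfl⟩
      exact output_reach_eq_zero h v) ∘ₗ
      (Submodule.Quotient.restrictScalarsEquiv ℝ R).symm.toLinearMap
  have hγ : ∀ u, γ (R.mkQ u) = S.C *ᵥ S.reach u := fun u => rfl
  refine ⟨⟨Module.finrank ℝ ((Fin k → ℝ[X]) ⧸ R), LinearMap.toMatrix b b α,
    LinearMap.toMatrix (Pi.basisFun ℝ (Fin k)) b β,
    LinearMap.toMatrix b (Pi.basisFun ℝ (Fin p)) γ, S.D⟩, hr, ?_⟩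
  refine transferFunction_eq_of_markov _ _ rfl fun j => ?_
  change LinearMap.toMatrix b (Pi.basisFun ℝ (Fin p)) γ * LinearMap.toMatrix b b α ^ j *
    LinearMap.toMatrix (Pi.basisFun ℝ (Fin k)) b β = _
  have hα : ∀ j x, (α ^ j) (R.mkQ x) = R.mkQ ((X : ℝ[X]) ^ j • x) := fun j x => by
    rw [map_smul]
    change ((Algebra.lsmul ℝ ℝ ((Fin k → ℝ[X]) ⧸ R) (X : ℝ[X])) ^ j) _ = _
    rw [← map_pow]
    rfl
  rw [LinearMap.toMatrix_pow, ← LinearMap.toMatrix_comp, ← LinearMap.toMatrix_comp]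
  ext a i
  have hβ : β (Pi.single i 1) = R.mkQ (Pi.single i 1) := by
    simp only [β, LinearMap.comp_apply, LinearMap.restrictScalars_apply]
    congr 1
    funext l
    by_cases hl : l = i
    · subst hl; simp
    · simp [hl]
  rw [LinearMap.toMatrix_apply]
  simp only [Pi.basisFun_apply, Pi.basisFun_repr, LinearMap.comp_apply]
  rw [hβ, hα, hγ, reach_X_pow_smul_single, Matrix.mul_assoc]
  rfl

theorem mcMillanDegree_eq_natDegree_det (h : IsRightCoprimeFraction S.transferFunction N M) :
    S.mcMillanDegree = M.det.natDegree := by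
  obtain ⟨T, hT, hTS⟩ := exists_realization h
  refine le_antisymm (Nat.sInf_le ⟨T, hT, hTS⟩) ?_
  obtain ⟨T', hT', hTS'⟩ := Nat.sInf_mem
    (⟨_, T, hT, hTS⟩ : {r | ∃ T : LTISystem k p, T.order = r ∧
      T.transferFunction = S.transferFunction}.Nonempty)
  rw [mcMillanDegree, ← hT']
  exact natDegree_det_le_order (S := T') (hTS' ▸ h)

end LTISystem

end McMillanDegree

/-! ### Graph symbols -/

section GraphSymbol

variable {k p : ℕ}

/-- The Bézout identity evaluates to a left inverse at every point. -/
theorem IsRightCoprimeFraction.fromRows_mulVec_injective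
    {P : Matrix (Fin p) (Fin k) (RatFunc ℝ)}
    {N : Matrix (Fin p) (Fin k) ℝ[X]} {M : Matrix (Fin k) (Fin k) ℝ[X]}
    (h : IsRightCoprimeFraction P N M) (s : ℂ) :
    Function.Injective (Matrix.fromRows (evalMatrix s M) (evalMatrix s N)).mulVec := by
  obtain ⟨U, V, hUV⟩ := h.coprime
  have h1 := congrArg (evalMatrix s) hUV
  rw [evalMatrix_add, evalMatrix_mul, evalMatrix_mul, evalMatrix_one,
    ← Matrix.fromCols_mul_fromRows] at h1
  intro x y hxy
  have h2 := congrArg (fun v => Matrix.fromCols (evalMatrix s U) (evalMatrix s V) *ᵥ v) hxy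
  simpa only [Matrix.mulVec_mulVec, h1, Matrix.one_mulVec] using h2

open scoped ComplexOrder in
theorem IsRightCoprimeFraction.isParaPosDef {P : Matrix (Fin p) (Fin k) (RatFunc ℝ)}
    {N : Matrix (Fin p) (Fin k) ℝ[X]} {M : Matrix (Fin k) (Fin k) ℝ[X]}
    (h : IsRightCoprimeFraction P N M) :
    IsParaPosDef (paraTranspose N * N + paraTranspose M * M) where
  para := by
    simp only [paraTranspose_add, paraTranspose_mul, paraTranspose_paraTranspose]
  posDef ω := by
    have h1 := Matrix.PosDef.conjTranspose_mul_self _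
      (h.fromRows_mulVec_injective ((ω : ℂ) * Complex.I))
    rw [Matrix.conjTranspose_fromRows_eq_fromCols_conjTranspose,
      Matrix.fromCols_mul_fromRows, add_comm] at h1
    simpa only [evalMatrix_add, evalMatrix_mul, evalMatrix_paraTranspose_axis] using h1

theorem IsRightCoprimeFraction.exists_isSpectralFactor
    {P : Matrix (Fin p) (Fin k) (RatFunc ℝ)}
    {N : Matrix (Fin p) (Fin k) ℝ[X]} {M : Matrix (Fin k) (Fin k) ℝ[X]}
    (h : IsRightCoprimeFraction P N M) : ∃ d, IsSpectralFactor N M d := by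
  obtain ⟨d, hd, hH⟩ := exists_spectral_factor h.isParaPosDef
  exact ⟨d, hd, hH⟩

theorem LTISystem.isGraphSymbol_graphSymbol {S : LTISystem k p}
    {N : Matrix (Fin p) (Fin k) ℝ[X]} {M : Matrix (Fin k) (Fin k) ℝ[X]}
    (h : IsRightCoprimeFraction S.transferFunction N M) :
    IsGraphSymbol S.transferFunction S.graphSymbol := by
  obtain ⟨d, hd⟩ := h.exists_isSpectralFactor
  exact Classical.epsilon_spec (p := IsGraphSymbol S.transferFunction)
    ⟨_, N, M, d, h, hd, fun _ => rfl⟩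

/-- The spectral factor in a graph symbol can be adapted to any given right-coprime fraction. -/
theorem LTISystem.exists_graphSymbol_eq {S : LTISystem k p}
    {N : Matrix (Fin p) (Fin k) ℝ[X]} {M : Matrix (Fin k) (Fin k) ℝ[X]}
    (h : IsRightCoprimeFraction S.transferFunction N M) :
    ∃ d, IsSpectralFactor N M d ∧ ∀ s : ℂ, S.graphSymbol s = Matrix.fromRows
      (evalMatrix s M * (evalMatrix s d)⁻¹) (evalMatrix s N * (evalMatrix s d)⁻¹) := by
  obtain ⟨N', M', d, hf, hd, hG⟩ := isGraphSymbol_graphSymbol h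
  obtain ⟨W, hW, hM, hN⟩ := h.exists_unimodular hf
  have hWi : W * W⁻¹ = 1 := Matrix.mul_nonsing_inv _ hW
  have hpara : paraTranspose W⁻¹ * paraTranspose W = 1 := by
    rw [← paraTranspose_mul, hWi, paraTranspose_one]
  refine ⟨d * W⁻¹, ⟨?_, ?_⟩, fun s => ?_⟩
  · have h1 := hd.factor
    rw [hM, hN, paraTranspose_mul, paraTranspose_mul] at h1
    calc paraTranspose N * N + paraTranspose M * M
        = (paraTranspose W⁻¹ * paraTranspose W) * (paraTranspose N * N + paraTranspose M * M) *
            (W * W⁻¹) := by rw [hWi, hpara, Matrix.one_mul, Matrix.mul_one]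
      _ = paraTranspose W⁻¹ * (paraTranspose W * paraTranspose N * (N * W) +
            paraTranspose W * paraTranspose M * (M * W)) * W⁻¹ := by
          simp only [Matrix.mul_add, Matrix.add_mul, Matrix.mul_assoc]
      _ = paraTranspose (d * W⁻¹) * (d * W⁻¹) := by
          rw [h1, paraTranspose_mul]; simp only [Matrix.mul_assoc]
  · rw [Matrix.det_mul]
    exact hd.hurwitz.mul (isHurwitz_of_isUnit (Matrix.isUnit_nonsing_inv_det _ hW))
  · have h2 : evalMatrix s W⁻¹ = (evalMatrix s W)⁻¹ := by
      refine (Matrix.inv_eq_right_inv ?_).symm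
      rw [← evalMatrix_mul, hWi, evalMatrix_one]
    have h3 : IsUnit (evalMatrix s W).det := by
      rw [det_evalMatrix]; exact hW.map (aeval s)
    rw [hG, hM, hN, evalMatrix_mul, evalMatrix_mul, evalMatrix_mul, h2, Matrix.mul_inv_rev,
      Matrix.nonsing_inv_nonsing_inv _ h3]
    simp only [Matrix.mul_assoc]

/-- On the imaginary axis a graph symbol is an isometry. -/
theorem IsSpectralFactor.conjTranspose_mul_self {N : Matrix (Fin p) (Fin k) ℝ[X]}
    {M d : Matrix (Fin k) (Fin k) ℝ[X]} (h : IsSpectralFactor N M d) (ω : ℝ) :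
    (Matrix.fromRows (evalMatrix (ω * Complex.I) M * (evalMatrix (ω * Complex.I) d)⁻¹)
      (evalMatrix (ω * Complex.I) N * (evalMatrix (ω * Complex.I) d)⁻¹))ᴴ *
    Matrix.fromRows (evalMatrix (ω * Complex.I) M * (evalMatrix (ω * Complex.I) d)⁻¹)
      (evalMatrix (ω * Complex.I) N * (evalMatrix (ω * Complex.I) d)⁻¹) = 1 := by
  set s := (ω : ℂ) * Complex.I with hs
  have hd : IsUnit (evalMatrix s d).det := by
    rw [det_evalMatrix]; exact (h.hurwitz.axis_ne_zero ω).isUnit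
  have h1 := congrArg (evalMatrix s) h.factor
  simp only [evalMatrix_add, evalMatrix_mul, hs, evalMatrix_paraTranspose_axis] at h1
  rw [← hs] at h1
  rw [Matrix.conjTranspose_fromRows_eq_fromCols_conjTranspose, Matrix.fromCols_mul_fromRows]
  have h2 : (evalMatrix s d)⁻¹ᴴ * (evalMatrix s d)ᴴ = 1 := by
    rw [← Matrix.conjTranspose_mul, Matrix.mul_nonsing_inv _ hd, Matrix.conjTranspose_one]
  calc _ = (evalMatrix s d)⁻¹ᴴ * ((evalMatrix s N)ᴴ * evalMatrix s N +
        (evalMatrix s M)ᴴ * evalMatrix s M) * (evalMatrix s d)⁻¹ := by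
        simp only [Matrix.conjTranspose_mul, Matrix.mul_add, Matrix.add_mul, Matrix.mul_assoc]
        rw [add_comm]
    _ = ((evalMatrix s d)⁻¹ᴴ * (evalMatrix s d)ᴴ) *
          (evalMatrix s d * (evalMatrix s d)⁻¹) := by
        rw [h1]; simp only [Matrix.mul_assoc]
    _ = 1 := by rw [h2, Matrix.mul_nonsing_inv _ hd, Matrix.one_mul]

end GraphSymbol

namespace LTISystem

variable {k p : ℕ} {S : LTISystem k p} {N : Matrix (Fin p) (Fin k) ℝ[X]}
  {M : Matrix (Fin k) (Fin k) ℝ[X]}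

/-- The identity `N = P M`, evaluated at the points off the spectrum of `A`. -/
theorem eventually_evalMatrix_numerator (h : IsRightCoprimeFraction S.transferFunction N M) :
    ∀ᶠ z : ℂ in Bornology.cobounded ℂ, evalMatrix z N =
      (S.C.map ((↑) : ℝ → ℂ) * (z • 1 - S.A.map ((↑) : ℝ → ℂ))⁻¹ * S.B.map ((↑) : ℝ → ℂ) +
        S.D.map ((↑) : ℝ → ℂ)) * evalMatrix z M := by
  have hu := isUnit_charmatrix_map_ratFunc S.A
  -- Clearing denominators gives a polynomial identity, which can be evaluated.
  have h1 : S.A.charpoly • N = (S.C.map Polynomial.C * S.A.charmatrix.adjugate *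
      S.B.map Polynomial.C + S.A.charpoly • S.D.map Polynomial.C) * M := by
    have hadj : S.A.charmatrix.adjugate.map (algebraMap ℝ[X] (RatFunc ℝ)) =
        algebraMap ℝ[X] (RatFunc ℝ) S.A.charpoly •
          (S.A.charmatrix.map (algebraMap ℝ[X] (RatFunc ℝ)))⁻¹ := by
      have h3 := (algebraMap ℝ[X] (RatFunc ℝ)).map_adjugate S.A.charmatrix
      have h4 := (algebraMap ℝ[X] (RatFunc ℝ)).map_det S.A.charmatrix
      simp only [RingHom.mapMatrix_apply] at h3 h4
      rw [h3, Matrix.inv_def, Matrix.charpoly, h4, smul_smul, Ring.mul_inverse_cancel _ hu,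
        one_smul]
    have hsmul : ∀ {a b : ℕ} (N : Matrix (Fin a) (Fin b) ℝ[X]),
        (S.A.charpoly • N).map (algebraMap ℝ[X] (RatFunc ℝ)) =
          algebraMap ℝ[X] (RatFunc ℝ) S.A.charpoly • N.map (algebraMap ℝ[X] (RatFunc ℝ)) := by
      intro a b N
      ext1 i j
      simp
    apply map_ratFunc_injective
    simp only [Matrix.map_mul, Matrix.map_add _ (map_add (algebraMap ℝ[X] (RatFunc ℝ))), hsmul,
      hadj, map_C_map_ratFunc]
    rw [← h.mul_eq, transferFunction_eq]
    simp only [Matrix.mul_smul, Matrix.smul_mul, ← smul_add, Matrix.add_mul]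
  filter_upwards [eventually_aeval_ne_zero S.A.charpoly_monic.ne_zero] with z hz
  have hconst : ∀ {a b : ℕ} (N : Matrix (Fin a) (Fin b) ℝ),
      evalMatrix z (N.map Polynomial.C) = N.map ((↑) : ℝ → ℂ) := by
    intro a b N
    ext1 i j
    simp [evalMatrix_apply]
  have hsmul : ∀ {a b : ℕ} (N : Matrix (Fin a) (Fin b) ℝ[X]),
      evalMatrix z (S.A.charpoly • N) = aeval z S.A.charpoly • evalMatrix z N := by
    intro a b N
    ext1 i j
    simp [evalMatrix_apply]
  have hadj : evalMatrix z S.A.charmatrix.adjugate =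
      aeval z S.A.charpoly • (z • 1 - S.A.map ((↑) : ℝ → ℂ))⁻¹ := by
    have h9 := (aeval z : ℝ[X] →ₐ[ℝ] ℂ).map_adjugate S.A.charmatrix
    simp only [AlgHom.mapMatrix_apply] at h9
    rw [evalMatrix, h9, ← evalMatrix_charmatrix, Matrix.inv_def, det_evalMatrix,
      ← Matrix.charpoly, smul_smul, Ring.mul_inverse_cancel _ hz.isUnit, one_smul]
    rfl
  have h2 := congrArg (evalMatrix z) h1
  simp only [hsmul, evalMatrix_mul, evalMatrix_add, hconst, hadj, Matrix.mul_smul,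
    Matrix.smul_mul, ← smul_add] at h2
  exact smul_right_injective _ hz h2

open scoped ComplexOrder in
/-- Properness of the transfer function: the spectral factor has the determinantal degree of the
denominator. -/
theorem natDegree_det_spectralFactor (h : IsRightCoprimeFraction S.transferFunction N M)
    {d : Matrix (Fin k) (Fin k) ℝ[X]} (hd : IsSpectralFactor N M d) :
    d.det.natDegree = M.det.natDegree := by
  set Dc := S.D.map ((↑) : ℝ → ℂ) with hDc
  set P : ℂ → Matrix (Fin p) (Fin k) ℂ := fun z =>
    S.C.map ((↑) : ℝ → ℂ) * (z • 1 - S.A.map ((↑) : ℝ → ℂ))⁻¹ * S.B.map ((↑) : ℝ → ℂ) + Dc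
    with hP
  have hlim : Tendsto (fun ω : ℝ => (1 + (P (ω * Complex.I))ᴴ * P (ω * Complex.I)).det) atTop
      (nhds (1 + Dcᴴ * Dc).det) := by
    have hc : Continuous fun K : Matrix (Fin S.order) (Fin S.order) ℂ =>
        (1 + (S.C.map ((↑) : ℝ → ℂ) * K * S.B.map ((↑) : ℝ → ℂ) + Dc)ᴴ *
          (S.C.map ((↑) : ℝ → ℂ) * K * S.B.map ((↑) : ℝ → ℂ) + Dc)).det := by
      fun_prop
    have := (hc.tendsto 0).comp ((tendsto_resolvent_matrix (S.A.map ((↑) : ℝ → ℂ))).comp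
      tendsto_axis_cobounded)
    simp only [Matrix.mul_zero, Matrix.zero_mul, zero_add] at this
    exact this
  have hpos : (1 + Dcᴴ * Dc).det ≠ 0 :=
    (Matrix.PosDef.one.add_posSemidef (Matrix.posSemidef_conjTranspose_mul_self Dc)).det_pos.ne'
  have hnorm : ∀ᶠ ω : ℝ in atTop, ‖aeval ((ω : ℂ) * Complex.I) (d.det ^ 2)‖ =
      ‖(1 + (P (ω * Complex.I))ᴴ * P (ω * Complex.I)).det‖ *
        ‖aeval ((ω : ℂ) * Complex.I) (M.det ^ 2)‖ := by
    filter_upwards [tendsto_axis_cobounded.eventually (eventually_evalMatrix_numerator h)]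
      with ω hω
    have h1 := congrArg (evalMatrix ((ω : ℂ) * Complex.I)) hd.factor
    simp only [evalMatrix_add, evalMatrix_mul, evalMatrix_paraTranspose_axis] at h1
    rw [hω] at h1
    change (P (ω * Complex.I) * _)ᴴ * (P (ω * Complex.I) * _) + _ = _ at h1
    have h2 : (evalMatrix ((ω : ℂ) * Complex.I) M)ᴴ *
        (1 + (P (ω * Complex.I))ᴴ * P (ω * Complex.I)) * evalMatrix ((ω : ℂ) * Complex.I) M =
        (evalMatrix ((ω : ℂ) * Complex.I) d)ᴴ * evalMatrix ((ω : ℂ) * Complex.I) d := by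
      rw [← h1, Matrix.conjTranspose_mul, Matrix.mul_add, Matrix.add_mul, Matrix.mul_one,
        add_comm]
      simp only [Matrix.mul_assoc]
    have h3 := congrArg (fun K => ‖Matrix.det K‖) h2
    simp only [Matrix.det_mul, Matrix.det_conjTranspose, norm_mul, norm_star,
      det_evalMatrix] at h3
    rw [map_pow, map_pow, norm_pow, norm_pow, pow_two, ← h3]
    ring
  have hn := hlim.norm
  have hc : 0 < ‖(1 + Dcᴴ * Dc).det‖ := norm_pos_iff.2 hpos
  apply le_antisymm
  · have h1 : (d.det ^ 2).natDegree ≤ (M.det ^ 2).natDegree := by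
      refine natDegree_le_of_norm_le (‖(1 + Dcᴴ * Dc).det‖ + 1) ?_
      filter_upwards [hnorm, hn.eventually_le_const (lt_add_one _)] with ω h2 h3
      rw [h2]
      gcongr
    rw [natDegree_pow, natDegree_pow] at h1
    omega
  · have h1 : (M.det ^ 2).natDegree ≤ (d.det ^ 2).natDegree := by
      refine natDegree_le_of_norm_le (‖(1 + Dcᴴ * Dc).det‖ / 2)⁻¹ ?_
      filter_upwards [hnorm, hn.eventually_const_le (half_lt_self hc)] with ω h2 h3
      rw [h2, inv_mul_eq_div, le_div_iff₀ (by positivity), mul_comm]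
      gcongr
    rw [natDegree_pow, natDegree_pow] at h1
    omega

/-- The time-conjugate system has the transfer function `P(-s)`. -/
theorem isRightCoprimeFraction_timeConj (h : IsRightCoprimeFraction S.transferFunction N M) :
    IsRightCoprimeFraction S.timeConj.transferFunction (N.map fun q => q.comp (-X))
      (M.map fun q => q.comp (-X)) := by
  have hinj : Function.Injective (compRingHom (-X : ℝ[X])) := fun q r hqr => by
    have := congrArg (fun q : ℝ[X] => q.comp (-X)) hqr
    simpa [comp_neg_X_comp_neg_X] using this
  let σ : RatFunc ℝ →+* RatFunc ℝ := IsFractionRing.map hinj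
  have hσ : ∀ q : ℝ[X], σ (algebraMap ℝ[X] (RatFunc ℝ) q) =
      algebraMap ℝ[X] (RatFunc ℝ) (q.comp (-X)) := fun q => IsLocalization.map_eq _ q
  have hdet : (M.map fun q => q.comp (-X)).det ≠ 0 := by
    rw [det_map_comp_neg_X]
    exact fun h0 => h.det_ne_zero (comp_neg_X_eq_zero_iff.1 h0)
  have hmap : ∀ {a b : ℕ} (K : Matrix (Fin a) (Fin b) ℝ[X]),
      (K.map (algebraMap ℝ[X] (RatFunc ℝ))).map σ =
        (K.map fun q => q.comp (-X)).map (algebraMap ℝ[X] (RatFunc ℝ)) := by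
    intro a b K
    ext1 i j
    exact hσ _
  have hconst : ∀ {a b : ℕ} (K : Matrix (Fin a) (Fin b) ℝ),
      (K.map RatFunc.C).map σ = K.map RatFunc.C := by
    intro a b K
    ext1 i j
    simp only [Matrix.map_apply]
    rw [← RatFunc.algebraMap_C, hσ, C_comp]
  have htf : S.timeConj.transferFunction = S.transferFunction.map σ := by
    have hu := isUnit_charmatrix_map_ratFunc S.A
    have h1 : ((S.A.charmatrix.map (algebraMap ℝ[X] (RatFunc ℝ)))⁻¹).map σ =
        -((-S.A).charmatrix.map (algebraMap ℝ[X] (RatFunc ℝ)))⁻¹ := by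
      have h2 := congrArg (fun K => K.map σ) (Matrix.mul_nonsing_inv _ hu)
      simp only [Matrix.map_mul, Matrix.map_one _ (map_zero σ) (map_one σ)] at h2
      have h3 : (S.A.charmatrix.map (algebraMap ℝ[X] (RatFunc ℝ))).map σ =
          -((-S.A).charmatrix.map (algebraMap ℝ[X] (RatFunc ℝ))) := by
        rw [charmatrix_map_ratFunc, Matrix.map_sub _ (map_sub σ), hconst,
          charmatrix_map_ratFunc]
        have h4 : σ RatFunc.X = -RatFunc.X := by
          rw [← RatFunc.algebraMap_X, hσ]
          simp
        ext1 i j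
        rcases eq_or_ne i j with rfl | hij
        · simp [h4, sub_eq_add_neg, add_comm]
        · simp [Matrix.one_apply_ne hij]
      rw [h3, Matrix.neg_mul, ← Matrix.mul_neg] at h2
      exact neg_eq_iff_eq_neg.1 (Matrix.inv_eq_right_inv h2).symm
    have h5 : (-S.B).map RatFunc.C = -S.B.map RatFunc.C := by
      ext1 i j
      simp
    have h6 : S.timeConj.transferFunction = S.C.map RatFunc.C *
        ((-S.A).charmatrix.map (algebraMap ℝ[X] (RatFunc ℝ)))⁻¹ * (-S.B).map RatFunc.C +
          S.D.map RatFunc.C := S.timeConj.transferFunction_eq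
    rw [h6, transferFunction_eq, Matrix.map_add _ (map_add σ), Matrix.map_mul,
      Matrix.map_mul, h1, hconst, hconst, hconst, h5, Matrix.mul_neg, Matrix.mul_neg,
      Matrix.neg_mul]
  refine ⟨?_, hdet, ?_⟩
  · obtain ⟨U, V, hUV⟩ := h.coprime
    refine ⟨U.map fun q => q.comp (-X), V.map fun q => q.comp (-X), ?_⟩
    have h1 := congrArg (fun K => K.map (compRingHom (-X : ℝ[X]))) hUV
    simp only [Matrix.map_add _ (map_add (compRingHom (-X : ℝ[X]))), Matrix.map_mul,
      Matrix.map_one _ (map_zero (compRingHom (-X : ℝ[X]))) (map_one _)] at h1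
    exact h1
  · have hu := isUnit_det_map_ratFunc hdet
    rw [htf, ← hmap, ← h.mul_eq, Matrix.map_mul, hmap, Matrix.mul_assoc,
      Matrix.mul_nonsing_inv _ hu, Matrix.mul_one]

end LTISystem

/-! ### Isometric matrices -/

section IsometricMatrix

variable {ι κ : Type} [Fintype ι] [Fintype κ]

theorem ofReal_norm_toLp_sq (v : ι → ℂ) :
    ((‖WithLp.toLp 2 v‖ ^ 2 : ℝ) : ℂ) = star v ⬝ᵥ v := by
  rw [EuclideanSpace.norm_sq_eq]
  simp [dotProduct, Complex.conj_mul']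

theorem star_dotProduct_mulVec (G : Matrix ι κ ℂ) (x : ι → ℂ) (u : κ → ℂ) :
    star x ⬝ᵥ (G *ᵥ u) = star (Gᴴ *ᵥ x) ⬝ᵥ u := by
  rw [Matrix.star_mulVec, Matrix.conjTranspose_conjTranspose, Matrix.dotProduct_mulVec]

theorem star_mulVec_dotProduct (G : Matrix ι κ ℂ) (x : ι → ℂ) (u : κ → ℂ) :
    star (G *ᵥ u) ⬝ᵥ x = star u ⬝ᵥ (Gᴴ *ᵥ x) := by
  rw [star_dotProduct_mulVec, Matrix.conjTranspose_conjTranspose]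

variable [DecidableEq κ]

/-- The distance from `x` to the range of an isometry `G`, by completing the square. -/
theorem norm_sub_mulVec_sq {G : Matrix ι κ ℂ} (hG : Gᴴ * G = 1) (x : ι → ℂ) (u : κ → ℂ) :
    ‖WithLp.toLp 2 (x - G *ᵥ u)‖ ^ 2 =
      ‖WithLp.toLp 2 x‖ ^ 2 - ‖WithLp.toLp 2 (Gᴴ *ᵥ x)‖ ^ 2 +
        ‖WithLp.toLp 2 (Gᴴ *ᵥ x - u)‖ ^ 2 := by
  have h : (((‖WithLp.toLp 2 (x - G *ᵥ u)‖ ^ 2 : ℝ)) : ℂ) =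
      ((‖WithLp.toLp 2 x‖ ^ 2 - ‖WithLp.toLp 2 (Gᴴ *ᵥ x)‖ ^ 2 +
        ‖WithLp.toLp 2 (Gᴴ *ᵥ x - u)‖ ^ 2 : ℝ) : ℂ) := by
    rw [Complex.ofReal_add, Complex.ofReal_sub]
    simp only [ofReal_norm_toLp_sq, star_sub, sub_dotProduct, dotProduct_sub,
      star_mulVec_dotProduct G, star_dotProduct_mulVec G, Matrix.mulVec_mulVec, hG,
      Matrix.one_mulVec]
    ring
  exact_mod_cast h

theorem norm_conjTranspose_mulVec_le {G : Matrix ι κ ℂ} (hG : Gᴴ * G = 1) (x : ι → ℂ) :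
    ‖WithLp.toLp 2 (Gᴴ *ᵥ x)‖ ≤ ‖WithLp.toLp 2 x‖ := by
  have h := norm_sub_mulVec_sq hG x (Gᴴ *ᵥ x)
  rw [sub_self, WithLp.toLp_zero, norm_zero] at h
  refine le_of_sq_le_sq ?_ (norm_nonneg _)
  nlinarith [sq_nonneg ‖WithLp.toLp 2 (x - G *ᵥ (Gᴴ *ᵥ x))‖]

theorem norm_isometry_mulVec {G : Matrix ι κ ℂ} (hG : Gᴴ * G = 1) (u : κ → ℂ) :
    ‖WithLp.toLp 2 (G *ᵥ u)‖ = ‖WithLp.toLp 2 u‖ := by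
  have h : ((‖WithLp.toLp 2 (G *ᵥ u)‖ ^ 2 : ℝ) : ℂ) = ((‖WithLp.toLp 2 u‖ ^ 2 : ℝ) : ℂ) := by
    rw [ofReal_norm_toLp_sq, ofReal_norm_toLp_sq, star_mulVec_dotProduct, Matrix.mulVec_mulVec,
      hG, Matrix.one_mulVec]
  have h' : ‖WithLp.toLp 2 (G *ᵥ u)‖ ^ 2 = ‖WithLp.toLp 2 u‖ ^ 2 := by exact_mod_cast h
  exact (pow_left_inj₀ (norm_nonneg _) (norm_nonneg _) two_ne_zero).1 h'

theorem norm_apply_le_norm_toLp_col (K : Matrix ι κ ℂ) (i : ι) (j : κ) :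
    ‖K i j‖ ≤ ‖WithLp.toLp 2 (K *ᵥ Pi.single j 1)‖ := by
  have h := PiLp.norm_apply_le (WithLp.toLp 2 (K *ᵥ Pi.single j (1 : ℂ))) i
  simpa using h

/-- A matrix without shrinking directions has a determinant bounded below. -/
theorem det_lower_bound {c : ℝ} (hc : 0 < c) (K : Matrix κ κ ℂ)
    (hK : ∀ v, c * ‖WithLp.toLp 2 v‖ ≤ ‖WithLp.toLp 2 (K *ᵥ v)‖) :
    ((Fintype.card κ).factorial * c⁻¹ ^ Fintype.card κ)⁻¹ ≤ ‖K.det‖ := by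
  have hdet : IsUnit K.det := by
    rw [isUnit_iff_ne_zero]
    intro h0
    obtain ⟨v, hv, hKv⟩ := Matrix.exists_mulVec_eq_zero_iff.2 h0
    have h1 := hK v
    rw [hKv, WithLp.toLp_zero, norm_zero] at h1
    have h2 : 0 < ‖WithLp.toLp 2 v‖ := norm_pos_iff.2 (by simpa using hv)
    nlinarith
  have h1 : ‖K⁻¹.det‖ ≤ (Fintype.card κ).factorial • c⁻¹ ^ Fintype.card κ := by
    refine Matrix.det_le (abv := NormedField.toAbsoluteValue ℂ) (x := c⁻¹) fun i j => ?_
    refine (norm_apply_le_norm_toLp_col K⁻¹ i j).trans ?_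
    have h2 := hK (K⁻¹ *ᵥ Pi.single j 1)
    rw [Matrix.mulVec_mulVec, Matrix.mul_nonsing_inv _ hdet, Matrix.one_mulVec] at h2
    rw [← one_div c, le_div_iff₀' hc]
    exact h2.trans (by simp)
  rw [Matrix.det_nonsing_inv, Ring.inverse_eq_inv', norm_inv, nsmul_eq_mul] at h1
  exact inv_le_of_inv_le₀ (norm_pos_iff.2 hdet.ne_zero) h1

theorem det_upper_bound {G : Matrix ι κ ℂ} {G' : Matrix ι κ ℂ} (hG : Gᴴ * G = 1)
    (hG' : G'ᴴ * G' = 1) : ‖(G'ᴴ * G).det‖ ≤ (Fintype.card κ).factorial := by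
  have h1 : ‖(G'ᴴ * G).det‖ ≤ (Fintype.card κ).factorial • (1 : ℝ) ^ Fintype.card κ := by
    refine Matrix.det_le (abv := NormedField.toAbsoluteValue ℂ) (x := 1) fun i j => ?_
    refine (norm_apply_le_norm_toLp_col _ i j).trans ?_
    rw [← Matrix.mulVec_mulVec]
    refine (norm_conjTranspose_mulVec_le hG' _).trans ?_
    rw [norm_isometry_mulVec hG]
    simp
  simpa using h1

end IsometricMatrix

/-! ### Square-integrable functions with values in the range of an isometry -/

section AxisIsometry

variable {k p : ℕ}

/-- A matrix function that is continuous and isometric on the imaginary axis. -/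
structure IsAxisIsometry (G : ℂ → Matrix (Fin k ⊕ Fin p) (Fin k) ℂ) : Prop where
  continuous : Continuous fun ω : ℝ => G (ω * Complex.I)
  isometry : ∀ ω : ℝ, (G (ω * Complex.I))ᴴ * G (ω * Complex.I) = 1

theorem IsGraphSymbol.isAxisIsometry {P : Matrix (Fin p) (Fin k) (RatFunc ℝ)}
    {G : ℂ → Matrix (Fin k ⊕ Fin p) (Fin k) ℂ} (h : IsGraphSymbol P G) :
    IsAxisIsometry G := by
  obtain ⟨N, M, d, -, hd, hG⟩ := h
  refine ⟨?_, fun ω => by rw [hG]; exact hd.conjTranspose_mul_self ω⟩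
  simp only [hG]
  have hc : Continuous fun ω : ℝ => (ω : ℂ) * Complex.I := by fun_prop
  have hinv : Continuous fun ω : ℝ => (evalMatrix ((ω : ℂ) * Complex.I) d)⁻¹ := by
    simp only [Matrix.inv_def, det_evalMatrix, Ring.inverse_eq_inv']
    exact ((d.det.continuous_aeval.comp hc).inv₀ fun ω => hd.hurwitz.axis_ne_zero ω).smul
      ((continuous_evalMatrix d).comp hc).matrix_adjugate
  refine continuous_matrix fun i j => ?_
  rcases i with i | i
  · exact (((continuous_evalMatrix M).comp hc).matrix_mul hinv).matrix_elem i j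
  · exact (((continuous_evalMatrix N).comp hc).matrix_mul hinv).matrix_elem i j

theorem aestronglyMeasurable_mulVec {ι κ : Type} [Fintype ι] [Fintype κ]
    {A : ℝ → Matrix κ ι ℂ} (hA : Continuous A) {f : ℝ → EuclideanSpace ℂ ι}
    (hf : AEStronglyMeasurable f volume) :
    AEStronglyMeasurable (fun ω => WithLp.toLp 2 (A ω *ᵥ (f ω).ofLp)) volume := by
  have h1 : Continuous fun q : ℝ × EuclideanSpace ℂ ι => q.2.ofLp :=
    (PiLp.continuous_ofLp 2 _).comp continuous_snd
  have hc : Continuous fun q : ℝ × EuclideanSpace ℂ ι => WithLp.toLp 2 (A q.1 *ᵥ q.2.ofLp) :=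
    (PiLp.continuous_toLp 2 _).comp ((hA.comp continuous_fst).matrix_mulVec h1)
  have hpair : AEStronglyMeasurable (fun ω : ℝ => (ω, f ω)) volume :=
    (continuous_id.aestronglyMeasurable (μ := volume)).prodMk hf
  exact hc.comp_aestronglyMeasurable hpair

/-- The subspace `G L₂` consists of the square-integrable functions with values in the ranges
of `G`. -/
theorem IsAxisIsometry.mem_symbolRange_iff {G : ℂ → Matrix (Fin k ⊕ Fin p) (Fin k) ℂ}
    (h : IsAxisIsometry G) (f : AxisL2 (Fin k ⊕ Fin p)) :
    f ∈ symbolRange G ↔ ∀ᵐ ω : ℝ, ∃ v, (f ω).ofLp = G (ω * Complex.I) *ᵥ v := by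
  refine ⟨fun ⟨w, hw⟩ => hw.mono fun ω hω => ⟨_, hω⟩, fun hf => ?_⟩
  have hmeas := aestronglyMeasurable_mulVec h.continuous.matrix_conjTranspose
    (Lp.aestronglyMeasurable f)
  have hle : ∀ ω : ℝ, ‖WithLp.toLp 2 ((G (ω * Complex.I))ᴴ *ᵥ (f ω).ofLp)‖ ≤ ‖f ω‖ :=
    fun ω => by
      have := norm_conjTranspose_mulVec_le (h.isometry ω) (f ω).ofLp
      rwa [WithLp.toLp_ofLp] at this
  have hmem := (Lp.memLp f).of_le hmeas (Eventually.of_forall hle)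
  refine ⟨hmem.toLp, ?_⟩
  filter_upwards [hf, hmem.coeFn_toLp] with ω ⟨v, hv⟩ hω
  have h1 : (G (ω * Complex.I))ᴴ *ᵥ (G (ω * Complex.I) *ᵥ v) = v := by
    rw [Matrix.mulVec_mulVec, h.isometry ω, Matrix.one_mulVec]
  rw [hω, hv, h1]

theorem axisL2_norm_sq {ι : Type} [Fintype ι] (f : AxisL2 ι) :
    ‖f‖ ^ 2 = ∫ ω, ‖f ω‖ ^ 2 := by
  have h := L2.inner_def (𝕜 := ℂ) f f
  simp only [inner_self_eq_norm_sq_to_K] at h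
  have h2 : ((‖f‖ ^ 2 : ℝ) : ℂ) = ((∫ ω, ‖f ω‖ ^ 2 : ℝ) : ℂ) := by
    rw [← integral_complex_ofReal]
    simpa using h
  exact_mod_cast h2

/-- An approximation of `G₁ L₂` by `G₂ L₂` with relative error `δ` bounds `G₂ᴴ G₁ v` below in the
mean over every interval: apply it to `G₁ v` cut off outside the interval. -/
theorem IsAxisIsometry.integral_bound {G₁ G₂ : ℂ → Matrix (Fin k ⊕ Fin p) (Fin k) ℂ}
    (h₁ : IsAxisIsometry G₁) (h₂ : IsAxisIsometry G₂) {δ : ℝ}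
    (h : ∀ f ∈ symbolRange G₁, ∃ g ∈ symbolRange G₂, ‖f - g‖ ≤ δ * ‖f‖)
    (v : Fin k → ℂ) {a b : ℝ} (hab : a ≤ b) :
    (1 - δ ^ 2) * ((b - a) * ‖WithLp.toLp 2 v‖ ^ 2) ≤
      ∫ ω in Set.Icc a b, ‖WithLp.toLp 2
        (((G₂ (ω * Complex.I))ᴴ * G₁ (ω * Complex.I)) *ᵥ v)‖ ^ 2 := by
  set F : ℝ → EuclideanSpace ℂ (Fin k ⊕ Fin p) := (Set.Icc a b).indicator
    fun ω => WithLp.toLp 2 (G₁ (ω * Complex.I) *ᵥ v) with hF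
  have hcont : Continuous fun ω : ℝ => WithLp.toLp 2 (G₁ (ω * Complex.I) *ᵥ v) :=
    (PiLp.continuous_toLp 2 _).comp (h₁.continuous.matrix_mulVec continuous_const)
  have hmem : MemLp F 2 volume := by
    rw [hF, memLp_indicator_iff_restrict measurableSet_Icc]
    exact MemLp.of_bound hcont.aestronglyMeasurable ‖WithLp.toLp 2 v‖
      (Eventually.of_forall fun ω => (norm_isometry_mulVec (h₁.isometry ω) v).le)
  set f : AxisL2 (Fin k ⊕ Fin p) := hmem.toLp with hf
  have hfF : f =ᵐ[volume] F := hmem.coeFn_toLp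
  have hfmem : f ∈ symbolRange G₁ := by
    rw [h₁.mem_symbolRange_iff]
    filter_upwards [hfF] with ω hω
    rw [hω, hF]
    by_cases hm : ω ∈ Set.Icc a b
    · exact ⟨v, by rw [Set.indicator_of_mem hm]⟩
    · exact ⟨0, by rw [Set.indicator_of_notMem hm]; simp⟩
  obtain ⟨g, ⟨w, hw⟩, hg⟩ := h f hfmem
  have hnf : ‖f‖ ^ 2 = (b - a) * ‖WithLp.toLp 2 v‖ ^ 2 := by
    rw [axisL2_norm_sq]
    have h1 : (fun ω => ‖f ω‖ ^ 2) =ᵐ[volume]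
        (Set.Icc a b).indicator fun _ => ‖WithLp.toLp 2 v‖ ^ 2 := by
      filter_upwards [hfF] with ω hω
      rw [hω, hF]
      by_cases hm : ω ∈ Set.Icc a b
      · rw [Set.indicator_of_mem hm, Set.indicator_of_mem hm,
          norm_isometry_mulVec (h₁.isometry ω)]
      · rw [Set.indicator_of_notMem hm, Set.indicator_of_notMem hm]; simp
    rw [integral_congr_ae h1, integral_indicator measurableSet_Icc]
    simp [hab]
  have hsq : ‖f - g‖ ^ 2 ≤ δ ^ 2 * ‖f‖ ^ 2 := by
    rw [← mul_pow]
    exact pow_le_pow_left₀ (norm_nonneg _) hg 2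
  -- Pointwise, projecting is at least as good as any other approximation from `G₂ L₂`.
  have hpt : ∀ᵐ ω : ℝ, ‖f ω‖ ^ 2 - ‖(f - g) ω‖ ^ 2 ≤ (Set.Icc a b).indicator
      (fun ω : ℝ => ‖WithLp.toLp 2
        (((G₂ (ω * Complex.I))ᴴ * G₁ (ω * Complex.I)) *ᵥ v)‖ ^ 2) ω := by
    filter_upwards [hfF, hw, Lp.coeFn_sub f g] with ω h1 h2 h3
    have h4 := norm_sub_mulVec_sq (h₂.isometry ω) (f ω).ofLp (w ω).ofLp
    rw [← h2, ← WithLp.ofLp_sub, WithLp.toLp_ofLp, WithLp.toLp_ofLp] at h4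
    rw [h3, Pi.sub_apply, h4]
    have h5 : ‖WithLp.toLp 2 ((G₂ (ω * Complex.I))ᴴ *ᵥ (f ω).ofLp)‖ ^ 2 =
        (Set.Icc a b).indicator (fun ω : ℝ => ‖WithLp.toLp 2
          (((G₂ (ω * Complex.I))ᴴ * G₁ (ω * Complex.I)) *ᵥ v)‖ ^ 2) ω := by
      rw [h1, hF]
      by_cases hm : ω ∈ Set.Icc a b
      · rw [Set.indicator_of_mem hm, Set.indicator_of_mem hm, Matrix.mulVec_mulVec]
      · rw [Set.indicator_of_notMem hm, Set.indicator_of_notMem hm]; simp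
    rw [h5]
    linarith [sq_nonneg ‖WithLp.toLp 2 ((G₂ (ω * Complex.I))ᴴ *ᵥ (f ω).ofLp - (w ω).ofLp)‖]
  have hcont2 : Continuous fun ω : ℝ => ‖WithLp.toLp 2
      (((G₂ (ω * Complex.I))ᴴ * G₁ (ω * Complex.I)) *ᵥ v)‖ ^ 2 :=
    (((PiLp.continuous_toLp 2 _).comp ((h₂.continuous.matrix_conjTranspose.matrix_mul
      h₁.continuous).matrix_mulVec continuous_const)).norm).pow 2
  have hint : ∀ q : AxisL2 (Fin k ⊕ Fin p), Integrable fun ω => ‖q ω‖ ^ 2 := fun q =>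
    MemLp.integrable_norm_pow (p := 2) (by simpa using Lp.memLp q) two_ne_zero
  have h6 := integral_mono_ae ((hint f).sub (hint (f - g)))
    ((hcont2.integrableOn_Icc).integrable_indicator measurableSet_Icc) hpt
  rw [integral_indicator measurableSet_Icc] at h6
  refine le_trans ?_ h6
  simp only [Pi.sub_apply]
  rw [integral_sub (hint f) (hint (f - g)), ← axisL2_norm_sq, ← axisL2_norm_sq]
  rw [← hnf]
  linarith

/-- By continuity the lower bound in the mean holds at every frequency. -/
theorem IsAxisIsometry.pointwise_bound {G₁ G₂ : ℂ → Matrix (Fin k ⊕ Fin p) (Fin k) ℂ}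
    (h₁ : IsAxisIsometry G₁) (h₂ : IsAxisIsometry G₂) {δ : ℝ}
    (h : ∀ f ∈ symbolRange G₁, ∃ g ∈ symbolRange G₂, ‖f - g‖ ≤ δ * ‖f‖)
    (v : Fin k → ℂ) (ω : ℝ) :
    (1 - δ ^ 2) * ‖WithLp.toLp 2 v‖ ^ 2 ≤ ‖WithLp.toLp 2
        (((G₂ (ω * Complex.I))ᴴ * G₁ (ω * Complex.I)) *ᵥ v)‖ ^ 2 := by
  have hcont : Continuous fun ω : ℝ => ‖WithLp.toLp 2
      (((G₂ (ω * Complex.I))ᴴ * G₁ (ω * Complex.I)) *ᵥ v)‖ ^ 2 :=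
    (((PiLp.continuous_toLp 2 _).comp ((h₂.continuous.matrix_conjTranspose.matrix_mul
      h₁.continuous).matrix_mulVec continuous_const)).norm).pow 2
  by_contra! hlt
  obtain ⟨c, hc1, hc2⟩ := exists_between hlt
  obtain ⟨ε, hε, hball⟩ := Metric.eventually_nhds_iff.1 (hcont.continuousAt.eventually_lt_const hc1)
  have h3 := h₁.integral_bound h₂ h v (a := ω) (b := ω + ε / 2) (by linarith)
  have h4 : ∫ ω in Set.Icc ω (ω + ε / 2), ‖WithLp.toLp 2
        (((G₂ (ω * Complex.I))ᴴ * G₁ (ω * Complex.I)) *ᵥ v)‖ ^ 2 ≤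
      ∫ _ in Set.Icc ω (ω + ε / 2), c := by
    refine setIntegral_mono_on hcont.integrableOn_Icc (by simp) measurableSet_Icc
      fun x hx => (hball ?_).le
    rw [Real.dist_eq, abs_lt]
    constructor <;> linarith [hx.1, hx.2]
  have h5 : ∫ _ in Set.Icc ω (ω + ε / 2), c = ε / 2 * c := by
    simp [show 0 ≤ ε / 2 by positivity]
  rw [h5] at h4
  nlinarith

end AxisIsometry

/-! ### The gap and its invariance under time conjugation -/

section Gap

variable {k p : ℕ}

/-- The strict inequality leaves room to approximate the projection, which lies in the closure of
`symbolRange`, by an element of `symbolRange` itself. -/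
theorem exists_approx_of_gapL2_lt {S₁ S₂ : LTISystem k p} {δ : ℝ} (h : gapL2 S₁ S₂ < δ)
    (f : AxisL2 (Fin k ⊕ Fin p)) (hf : f ∈ symbolRange S₁.graphSymbol) :
    ∃ g ∈ symbolRange S₂.graphSymbol, ‖f - g‖ ≤ δ * ‖f‖ := by
  by_cases hf0 : f = 0
  · exact ⟨0, Submodule.zero_mem _, by simp [hf0]⟩
  have hpos : 0 < ‖f‖ := norm_pos_iff.2 hf0
  have h1 : S₁.graphProjection f = f :=
    Submodule.starProjection_eq_self_iff.2 (Submodule.le_topologicalClosure _ hf)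
  have h2 : S₂.graphProjection f ∈ (symbolRange S₂.graphSymbol).topologicalClosure :=
    Submodule.starProjection_apply_mem _ f
  have h3 : ‖f - S₂.graphProjection f‖ ≤ gapL2 S₁ S₂ * ‖f‖ := by
    have := (S₁.graphProjection - S₂.graphProjection).le_opNorm f
    rwa [sub_apply, h1] at this
  rw [← SetLike.mem_coe, Submodule.topologicalClosure_coe, Metric.mem_closure_iff] at h2
  obtain ⟨g, hg, hdist⟩ := h2 ((δ - gapL2 S₁ S₂) * ‖f‖) (mul_pos (sub_pos.2 h) hpos)
  refine ⟨g, hg, ?_⟩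
  rw [dist_eq_norm] at hdist
  calc ‖f - g‖ = ‖(f - S₂.graphProjection f) + (S₂.graphProjection f - g)‖ := by
        rw [sub_add_sub_cancel]
    _ ≤ gapL2 S₁ S₂ * ‖f‖ + (δ - gapL2 S₁ S₂) * ‖f‖ := (norm_add_le _ _).trans
        (add_le_add h3 hdist.le)
    _ = δ * ‖f‖ := by ring

/-- If the gap is less than `1`, then `det (G₂(-s)ᵀ G₁(s))` is bounded away from zero on the
imaginary axis. -/
theorem exists_det_lower_bound {S₁ S₂ : LTISystem k p}
    (h₁ : IsAxisIsometry S₁.graphSymbol) (h₂ : IsAxisIsometry S₂.graphSymbol)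
    (h : gapL2 S₁ S₂ < 1) :
    ∃ c : ℝ, 0 < c ∧ ∀ ω : ℝ, c ≤
      ‖((S₂.graphSymbol (ω * Complex.I))ᴴ * S₁.graphSymbol (ω * Complex.I)).det‖ := by
  obtain ⟨δ, hδ, hδ1⟩ := exists_between h
  have hδ0 : 0 ≤ δ := (norm_nonneg _).trans hδ.le
  have hc : 0 < 1 - δ ^ 2 := by nlinarith
  have hs : 0 < √(1 - δ ^ 2) := Real.sqrt_pos.2 hc
  refine ⟨_, ?_, fun ω => det_lower_bound hs _ fun v => ?_⟩
  · positivity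
  · refine le_of_sq_le_sq ?_ (norm_nonneg _)
    rw [mul_pow, Real.sq_sqrt hc.le]
    exact h₁.pointwise_bound h₂ (exists_approx_of_gapL2_lt hδ) v ω

/-- The graph in terms of a fraction alone: the spectral factor is invertible on the axis. -/
theorem LTISystem.mem_symbolRange_graphSymbol_iff {S : LTISystem k p}
    {N : Matrix (Fin p) (Fin k) ℝ[X]} {M : Matrix (Fin k) (Fin k) ℝ[X]}
    (h : IsRightCoprimeFraction S.transferFunction N M) (f : AxisL2 (Fin k ⊕ Fin p)) :
    f ∈ symbolRange S.graphSymbol ↔ ∀ᵐ ω : ℝ, ∃ v, (f ω).ofLp =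
      Matrix.fromRows (evalMatrix (ω * Complex.I) M) (evalMatrix (ω * Complex.I) N) *ᵥ v := by
  rw [(LTISystem.isGraphSymbol_graphSymbol h).isAxisIsometry.mem_symbolRange_iff]
  obtain ⟨d, hd, hG⟩ := LTISystem.exists_graphSymbol_eq h
  refine eventually_congr (Eventually.of_forall fun ω => ?_)
  set s := (ω : ℂ) * Complex.I with hs
  have hdu : IsUnit (evalMatrix s d).det := by
    rw [det_evalMatrix]; exact (hd.hurwitz.axis_ne_zero ω).isUnit
  rw [hG, ← Matrix.fromRows_mul]
  constructor
  · rintro ⟨v, hv⟩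
    exact ⟨_, by rw [hv, ← Matrix.mulVec_mulVec]⟩
  · rintro ⟨v, hv⟩
    refine ⟨evalMatrix s d *ᵥ v, ?_⟩
    rw [hv, Matrix.mulVec_mulVec, Matrix.mul_assoc, Matrix.nonsing_inv_mul _ hdu,
      Matrix.mul_one]

/-- The unitary reflection `f(iω) ↦ f(-iω)`. -/
noncomputable def axisReflection (ι : Type) [Fintype ι] : AxisL2 ι ≃ₗᵢ[ℂ] AxisL2 ι :=
  LinearIsometryEquiv.ofSurjective
    (Lp.compMeasurePreservingₗᵢ ℂ (fun ω : ℝ => -ω) (Measure.measurePreserving_neg volume))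
    fun f => by
      have hmp := Measure.measurePreserving_neg (volume : Measure ℝ)
      refine ⟨Lp.compMeasurePreserving (fun ω : ℝ => -ω) hmp f, Lp.ext ?_⟩
      have h1 := Lp.coeFn_compMeasurePreserving f hmp
      have h2 := Lp.coeFn_compMeasurePreserving
        (Lp.compMeasurePreserving (fun ω : ℝ => -ω) hmp f) hmp
      filter_upwards [h2, hmp.quasiMeasurePreserving.ae h1] with ω hω hω'
      refine hω.trans (hω'.trans ?_)
      simp

theorem axisReflection_ae {ι : Type} [Fintype ι] (f : AxisL2 ι) :
    ∀ᵐ ω : ℝ, axisReflection ι f ω = f (-ω) :=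
  Lp.coeFn_compMeasurePreserving f (Measure.measurePreserving_neg volume)

/-- The reflection of the axis carries the graph of the time-conjugate system to that of the
system. -/
theorem LTISystem.symbolRange_timeConj {S : LTISystem k p}
    {N : Matrix (Fin p) (Fin k) ℝ[X]} {M : Matrix (Fin k) (Fin k) ℝ[X]}
    (h : IsRightCoprimeFraction S.transferFunction N M) :
    symbolRange S.graphSymbol = (symbolRange S.timeConj.graphSymbol).map
      ((axisReflection (Fin k ⊕ Fin p)).toLinearEquiv : _ →ₗ[ℂ] _) := by
  have hmp := (Measure.measurePreserving_neg (volume : Measure ℝ)).quasiMeasurePreserving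
  have hneg : ∀ (ω : ℝ) {a b : ℕ} (K : Matrix (Fin a) (Fin b) ℝ[X]),
      evalMatrix (((-ω : ℝ) : ℂ) * Complex.I) (K.map fun q => q.comp (-X)) =
        evalMatrix ((ω : ℂ) * Complex.I) K := by
    intro ω a b K
    ext1 i j
    simp [evalMatrix_apply, aeval_comp_neg_X]
  have key : ∀ f, f ∈ symbolRange S.timeConj.graphSymbol ↔
      axisReflection (Fin k ⊕ Fin p) f ∈ symbolRange S.graphSymbol := fun f => by
    rw [LTISystem.mem_symbolRange_graphSymbol_iff h,
      LTISystem.mem_symbolRange_graphSymbol_iff (isRightCoprimeFraction_timeConj h)]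
    constructor
    · intro hf
      filter_upwards [hmp.ae hf, axisReflection_ae f] with ω hω hR
      rw [hneg, hneg] at hω
      rwa [hR]
    · intro hf
      filter_upwards [hmp.ae hf, hmp.ae (axisReflection_ae f)] with ω hω hR
      rw [hR, neg_neg, ← hneg (-ω) M, ← hneg (-ω) N, neg_neg] at hω
      exact hω
  ext f
  rw [Submodule.mem_map]
  constructor
  · intro hf
    refine ⟨(axisReflection _).symm f, (key _).2 ?_, ?_⟩
    · rwa [LinearIsometryEquiv.apply_symm_apply]
    · exact LinearIsometryEquiv.apply_symm_apply _ _
  · rintro ⟨g, hg, rfl⟩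
    exact (key g).1 hg

theorem Submodule.map_topologicalClosure_linearIsometryEquiv {E : Type*}
    [NormedAddCommGroup E] [InnerProductSpace ℂ E] (e : E ≃ₗᵢ[ℂ] E) (K : Submodule ℂ E) :
    (K.map (e.toLinearEquiv : E →ₗ[ℂ] E)).topologicalClosure =
      K.topologicalClosure.map (e.toLinearEquiv : E →ₗ[ℂ] E) := by
  apply SetLike.coe_injective
  rw [Submodule.topologicalClosure_coe, Submodule.map_coe, Submodule.map_coe,
    Submodule.topologicalClosure_coe]
  exact (e.toHomeomorph.image_closure (K : Set E)).symm

/-- Time conjugation conjugates both projections by the same unitary reflection. -/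
theorem gapL2_timeConj {S₁ S₂ : LTISystem k p}
    {N₁ N₂ : Matrix (Fin p) (Fin k) ℝ[X]} {M₁ M₂ : Matrix (Fin k) (Fin k) ℝ[X]}
    (h₁ : IsRightCoprimeFraction S₁.transferFunction N₁ M₁)
    (h₂ : IsRightCoprimeFraction S₂.transferFunction N₂ M₂) :
    gapL2 S₁.timeConj S₂.timeConj = gapL2 S₁ S₂ := by
  set R := axisReflection (Fin k ⊕ Fin p)
  have hproj : ∀ {S : LTISystem k p} {N : Matrix (Fin p) (Fin k) ℝ[X]}
      {M : Matrix (Fin k) (Fin k) ℝ[X]}, IsRightCoprimeFraction S.transferFunction N M →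
      ∀ f, S.graphProjection f = R (S.timeConj.graphProjection (R.symm f)) := by
    intro S N M h f
    rw [LTISystem.graphProjection, LTISystem.graphProjection]
    rw [← Submodule.starProjection_map_apply]
    congr 2
    rw [LTISystem.symbolRange_timeConj h, Submodule.map_topologicalClosure_linearIsometryEquiv]
  have h : S₁.graphProjection - S₂.graphProjection =
      R.toLinearIsometry.toContinuousLinearMap ∘L
        ((S₁.timeConj.graphProjection - S₂.timeConj.graphProjection) ∘L
          (R.symm : AxisL2 (Fin k ⊕ Fin p) →L[ℂ] AxisL2 (Fin k ⊕ Fin p))) := by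
    ext1 f
    rw [sub_apply, hproj h₁, hproj h₂, ← map_sub]
    rfl
  rw [gapL2, gapL2, h, LinearIsometry.norm_toContinuousLinearMap_comp]
  exact (ContinuousLinearMap.opNorm_comp_linearIsometryEquiv _ R.symm).symm

end Gap

/-! ### Winding numbers along the D-contour -/

section Winding

theorem axis_mem_nyquistContour {R ω : ℝ} (h : ω ∈ Set.uIcc (-R) R) (hR : 0 ≤ R) :
    (ω : ℂ) * Complex.I ∈ nyquistContour R := by
  rw [Set.uIcc_of_le (by linarith)] at h
  left
  simpa [abs_le] using h

theorem arc_mem_nyquistContour {R θ : ℝ}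
    (h : θ ∈ Set.uIcc (-(Real.pi / 2)) (Real.pi / 2)) (hR : 0 ≤ R) :
    (R : ℂ) * Complex.exp (θ * Complex.I) ∈ nyquistContour R := by
  rw [Set.uIcc_of_le (by linarith [Real.pi_pos])] at h
  right
  refine ⟨?_, ?_⟩
  · rw [Complex.re_ofReal_mul, Complex.exp_ofReal_mul_I_re]
    exact mul_nonneg hR (Real.cos_nonneg_of_mem_Icc h)
  · rw [norm_mul, Complex.norm_exp_ofReal_mul_I, Complex.norm_real, mul_one]
    exact abs_of_nonneg hR

theorem nyquistIntegral_congr {f g : ℂ → ℂ} {R : ℝ} (hR : 0 ≤ R)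
    (h : ∀ s ∈ nyquistContour R, f s = g s) : nyquistIntegral f R = nyquistIntegral g R := by
  unfold nyquistIntegral
  congr 1
  · exact intervalIntegral.integral_congr fun ω hω => by
      rw [h _ (axis_mem_nyquistContour hω hR)]
  · exact intervalIntegral.integral_congr fun θ hθ => by
      rw [h _ (arc_mem_nyquistContour hθ hR)]

theorem intervalIntegrable_axis {f : ℂ → ℂ} {R : ℝ} (hR : 0 ≤ R)
    (hf : ContinuousOn f (nyquistContour R)) :
    IntervalIntegrable (fun ω : ℝ => f (ω * Complex.I) * Complex.I) volume (-R) R := by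
  refine ContinuousOn.intervalIntegrable (ContinuousOn.mul ?_ continuousOn_const)
  exact hf.comp (by fun_prop) fun ω hω => axis_mem_nyquistContour hω hR

theorem intervalIntegrable_arc {f : ℂ → ℂ} {R : ℝ} (hR : 0 ≤ R)
    (hf : ContinuousOn f (nyquistContour R)) :
    IntervalIntegrable (fun θ : ℝ => f (R * Complex.exp (θ * Complex.I)) *
      (R * Complex.exp (θ * Complex.I) * Complex.I)) volume
      (-(Real.pi / 2)) (Real.pi / 2) := by
  refine ContinuousOn.intervalIntegrable (ContinuousOn.mul ?_ (by fun_prop))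
  exact hf.comp (by fun_prop) fun ω hω => arc_mem_nyquistContour hω hR

theorem nyquistIntegral_add {f g : ℂ → ℂ} {R : ℝ} (hR : 0 ≤ R)
    (hf : ContinuousOn f (nyquistContour R)) (hg : ContinuousOn g (nyquistContour R)) :
    nyquistIntegral (fun s => f s + g s) R = nyquistIntegral f R + nyquistIntegral g R := by
  unfold nyquistIntegral
  simp only [add_mul]
  rw [intervalIntegral.integral_add (intervalIntegrable_axis hR hf)
    (intervalIntegrable_axis hR hg), intervalIntegral.integral_add
    (intervalIntegrable_arc hR hf) (intervalIntegrable_arc hR hg)]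
  ring

theorem nyquistIntegral_sub {f g : ℂ → ℂ} {R : ℝ} (hR : 0 ≤ R)
    (hf : ContinuousOn f (nyquistContour R)) (hg : ContinuousOn g (nyquistContour R)) :
    nyquistIntegral (fun s => f s - g s) R = nyquistIntegral f R - nyquistIntegral g R := by
  unfold nyquistIntegral
  simp only [sub_mul]
  rw [intervalIntegral.integral_sub (intervalIntegrable_axis hR hf)
    (intervalIntegrable_axis hR hg), intervalIntegral.integral_sub
    (intervalIntegrable_arc hR hf) (intervalIntegrable_arc hR hg)]
  ring

theorem exp_pi_half_mul_I : Complex.exp (((Real.pi / 2 : ℝ) : ℂ) * Complex.I) = Complex.I := by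
  rw [Complex.ofReal_div, Complex.ofReal_ofNat, Complex.exp_pi_div_two_mul_I]

theorem exp_neg_pi_half_mul_I :
    Complex.exp (((-(Real.pi / 2) : ℝ) : ℂ) * Complex.I) = -Complex.I := by
  rw [Complex.ofReal_neg, neg_mul, Complex.exp_neg, exp_pi_half_mul_I, Complex.inv_I]

theorem exp_three_pi_half_mul_I :
    Complex.exp (((3 * (Real.pi / 2) : ℝ) : ℂ) * Complex.I) = -Complex.I := by
  have : (((3 * (Real.pi / 2) : ℝ) : ℂ) * Complex.I) =
      ((-(Real.pi / 2) : ℝ) : ℂ) * Complex.I + 2 * Real.pi * Complex.I := by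
    push_cast; ring
  rw [this, Complex.exp_periodic, exp_neg_pi_half_mul_I]

theorem hasDerivAt_axis (ω : ℝ) :
    HasDerivAt (fun ω : ℝ => (ω : ℂ) * Complex.I) Complex.I ω := by
  simpa using (Complex.ofRealCLM.hasDerivAt (x := ω)).mul_const Complex.I

theorem hasDerivAt_arc (R θ : ℝ) :
    HasDerivAt (fun θ : ℝ => (R : ℂ) * Complex.exp (θ * Complex.I))
      (R * Complex.exp (θ * Complex.I) * Complex.I) θ := by
  simpa [mul_assoc] using ((hasDerivAt_axis θ).cexp).const_mul (R : ℂ)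

/-- Along a curve on which `c (s - a)` has positive real part, `log (c (s - a))` is a primitive of
`1 / (s - a)`. The constant `c = ±1` selects the side of `a`. -/
theorem integral_inv_sub_of_re_pos {γ γ' : ℝ → ℂ} {a : ℂ} (c : ℂ) (hc : c ≠ 0) {t₀ t₁ : ℝ}
    (hγ : ∀ t, HasDerivAt γ (γ' t) t) (hγ' : Continuous γ')
    (hre : ∀ t ∈ Set.uIcc t₀ t₁, 0 < (c * (γ t - a)).re) :
    ∫ t in t₀..t₁, (γ t - a)⁻¹ * γ' t =
      Complex.log (c * (γ t₁ - a)) - Complex.log (c * (γ t₀ - a)) := by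
  have hcont : Continuous γ := continuous_iff_continuousAt.2 fun t => (hγ t).continuousAt
  have hne : ∀ t ∈ Set.uIcc t₀ t₁, γ t - a ≠ 0 := fun t ht h0 => by
    have := hre t ht
    rw [h0] at this
    simp at this
  refine intervalIntegral.integral_eq_sub_of_hasDerivAt
    (f := fun t => Complex.log (c * (γ t - a))) (fun t ht => ?_) ?_
  · have h1 := (((hγ t).sub_const a).const_mul c).clog_real (Or.inl (hre t ht))
    have h2 := hne t ht
    convert! h1 using 1
    field_simp
  · refine ContinuousOn.intervalIntegrable (ContinuousOn.mul ?_ hγ'.continuousOn)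
    exact (hcont.sub continuous_const).continuousOn.inv₀ hne

theorem nyquistIntegral_inv_sub_of_re_neg {a : ℂ} (ha : a.re < 0) {R : ℝ} (hR : 0 ≤ R) :
    nyquistIntegral (fun s => (s - a)⁻¹) R = 0 := by
  unfold nyquistIntegral
  rw [integral_inv_sub_of_re_pos 1 one_ne_zero hasDerivAt_axis continuous_const
      (fun t _ => by simpa using ha),
    integral_inv_sub_of_re_pos 1 one_ne_zero (hasDerivAt_arc R) (by fun_prop) fun t ht => by
      have h1 : 0 ≤ ((R : ℂ) * Complex.exp (t * Complex.I)).re := by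
        rcases arc_mem_nyquistContour ht hR with h | h
        · exact h.1.ge
        · exact h.1
      rw [one_mul, Complex.sub_re]
      linarith,
    exp_pi_half_mul_I, exp_neg_pi_half_mul_I]
  simp

/-- A simple zero inside the D-contour contributes `-2πi`, as the contour runs clockwise. -/
theorem nyquistIntegral_inv_sub_of_re_pos {a : ℂ} (ha : 0 < a.re) {R : ℝ} (hR : ‖a‖ < R) :
    nyquistIntegral (fun s => (s - a)⁻¹) R = -(2 * Real.pi * Complex.I) := by
  have hR0 : 0 ≤ R := (norm_nonneg _).trans hR.le
  set F : ℝ → ℂ := fun θ => ((R : ℂ) * Complex.exp (θ * Complex.I) - a)⁻¹ *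
    (R * Complex.exp (θ * Complex.I) * Complex.I) with hF
  have hne : ∀ θ : ℝ, (R : ℂ) * Complex.exp (θ * Complex.I) - a ≠ 0 := fun θ h0 => by
    have h1 : ‖(R : ℂ) * Complex.exp (θ * Complex.I)‖ = R := by
      rw [norm_mul, Complex.norm_exp_ofReal_mul_I, Complex.norm_real, mul_one]
      exact abs_of_nonneg hR0
    rw [sub_eq_zero] at h0
    rw [h0] at h1
    exact hR.ne h1
  have hcont : Continuous F := by
    refine Continuous.mul (Continuous.inv₀ (by fun_prop) hne) (by fun_prop)
  -- The whole circle contributes `2πi`; the left arc has a logarithm as primitive.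
  have hfull : ∫ θ in (0 : ℝ)..2 * Real.pi, F θ = 2 * Real.pi * Complex.I := by
    have h1 := circleIntegral.integral_sub_inv_of_mem_ball (c := (0 : ℂ)) (w := a) (R := R)
      (by simpa using hR)
    rw [circleIntegral] at h1
    rw [← h1]
    refine intervalIntegral.integral_congr fun θ _ => ?_
    simp only [hF, deriv_circleMap, smul_eq_mul, circleMap, zero_add]
    ring
  have hper : Function.Periodic F (2 * Real.pi) := fun θ => by
    have : Complex.exp (((θ + 2 * Real.pi : ℝ) : ℂ) * Complex.I) =
        Complex.exp (θ * Complex.I) := by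
      push_cast
      rw [add_mul, Complex.exp_periodic]
    simp only [hF, this]
  have hsplit : (∫ θ in (-(Real.pi / 2))..(Real.pi / 2), F θ) +
      ∫ θ in (Real.pi / 2)..(3 * (Real.pi / 2)), F θ = 2 * Real.pi * Complex.I := by
    rw [intervalIntegral.integral_add_adjacent_intervals (hcont.intervalIntegrable _ _)
      (hcont.intervalIntegrable _ _), ← hfull]
    have h1 := hper.intervalIntegral_add_eq (-(Real.pi / 2)) 0
    rw [zero_add] at h1
    rw [← h1]
    congr 1
    ring
  have hleft : ∫ θ in (Real.pi / 2)..(3 * (Real.pi / 2)), F θ =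
      Complex.log (-1 * (R * -Complex.I - a)) - Complex.log (-1 * (R * Complex.I - a)) := by
    rw [hF, integral_inv_sub_of_re_pos (-1) (by norm_num) (hasDerivAt_arc R) (by fun_prop)
      fun t ht => ?_, exp_pi_half_mul_I, exp_three_pi_half_mul_I]
    rw [Set.uIcc_of_le (by linarith [Real.pi_pos])] at ht
    have h1 : Real.cos t ≤ 0 :=
      Real.cos_nonpos_of_pi_div_two_le_of_le ht.1 (by linarith [ht.2])
    have h2 : ((R : ℂ) * Complex.exp (t * Complex.I)).re ≤ 0 := by
      rw [Complex.re_ofReal_mul, Complex.exp_ofReal_mul_I_re]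
      exact mul_nonpos_of_nonneg_of_nonpos hR0 h1
    rw [neg_one_mul, Complex.neg_re, Complex.sub_re]
    linarith
  have haxis : ∫ ω in (-R)..R, ((ω : ℂ) * Complex.I - a)⁻¹ * Complex.I =
      Complex.log (-1 * (R * Complex.I - a)) - Complex.log (-1 * (R * -Complex.I - a)) := by
    rw [integral_inv_sub_of_re_pos (-1) (by norm_num) hasDerivAt_axis continuous_const
      (fun t _ => by simpa using ha)]
    simp
  change (∫ ω in (-R)..R, ((ω : ℂ) * Complex.I - a)⁻¹ * Complex.I) -
    ∫ θ in (-(Real.pi / 2))..(Real.pi / 2), F θ = _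
  rw [haxis, eq_sub_of_add_eq hsplit, hleft]
  ring

theorem nyquistContour_ne {a s : ℂ} (ha : a.re ≠ 0) {R : ℝ} (hR : ‖a‖ < R)
    (hs : s ∈ nyquistContour R) : s - a ≠ 0 := by
  intro h0
  rw [sub_eq_zero] at h0
  subst h0
  rcases hs with h | h
  · exact ha h.1
  · exact hR.ne h.2

theorem nyquistIntegral_sum_inv_sub (S : Multiset ℂ) {R : ℝ} (hR : 0 ≤ R)
    (hS : ∀ a ∈ S, a.re ≠ 0 ∧ ‖a‖ < R) :
    ContinuousOn (fun s => (S.map fun a => 1 / (s - a)).sum) (nyquistContour R) ∧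
    nyquistIntegral (fun s => (S.map fun a => 1 / (s - a)).sum) R =
      -(2 * Real.pi * Complex.I) * (S.countP fun a => 0 < a.re) := by
  induction S using Multiset.induction_on with
  | empty => simp [nyquistIntegral, continuousOn_const]
  | cons a S ih =>
    obtain ⟨hc, hi⟩ := ih fun b hb => hS b (Multiset.mem_cons_of_mem hb)
    obtain ⟨ha, haR⟩ := hS a (Multiset.mem_cons_self a S)
    have hca : ContinuousOn (fun s => (s - a)⁻¹) (nyquistContour R) :=
      ContinuousOn.inv₀ (by fun_prop) fun s hs => nyquistContour_ne ha haR hs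
    simp only [Multiset.map_cons, Multiset.sum_cons, one_div] at hc hi ⊢
    refine ⟨hca.add hc, ?_⟩
    rw [nyquistIntegral_add hR hca hc, hi]
    rcases lt_or_gt_of_ne ha with h | h
    · rw [nyquistIntegral_inv_sub_of_re_neg h hR,
        Multiset.countP_cons_of_neg (p := fun a : ℂ => 0 < a.re) S (not_lt.2 h.le), zero_add]
    · rw [nyquistIntegral_inv_sub_of_re_pos h haR,
        Multiset.countP_cons_of_pos (p := fun a : ℂ => 0 < a.re) S h]
      push_cast
      ring

/-- The argument principle for a polynomial without zeros on the imaginary axis: the D-contour is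
traversed clockwise. -/
theorem eventually_nyquistIntegral_logDeriv {q : ℝ[X]} (hq : q ≠ 0)
    (hre : ∀ z : ℂ, aeval z q = 0 → z.re ≠ 0) :
    ∀ᶠ R : ℝ in atTop, (∀ s ∈ nyquistContour R, aeval s q ≠ 0) ∧
      ContinuousOn (logDeriv fun s : ℂ => aeval s q) (nyquistContour R) ∧
      nyquistIntegral (logDeriv fun s : ℂ => aeval s q) R =
        -(2 * Real.pi * Complex.I) *
          ((q.map (algebraMap ℝ ℂ)).roots.countP fun a => 0 < a.re) := by
  set Q := q.map (algebraMap ℝ ℂ) with hQ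
  have hQ0 : Q ≠ 0 := (Polynomial.map_ne_zero_iff (algebraMap ℝ ℂ).injective).2 hq
  have hroot : ∀ a, a ∈ Q.roots ↔ aeval a q = 0 := fun a => by
    rw [mem_roots hQ0, IsRoot, hQ, eval_map_algebraMap]
  have hbound : ∀ᶠ R : ℝ in atTop, ∀ a ∈ Q.roots.toFinset, ‖a‖ < R :=
    (Finset.eventually_all _).2 fun a _ => eventually_gt_atTop _
  filter_upwards [hbound, eventually_ge_atTop 0] with R hb hR
  have hS : ∀ a ∈ Q.roots, a.re ≠ 0 ∧ ‖a‖ < R := fun a ha =>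
    ⟨hre a ((hroot a).1 ha), hb a (Multiset.mem_toFinset.2 ha)⟩
  have hne : ∀ s ∈ nyquistContour R, aeval s q ≠ 0 := fun s hs h0 => by
    have h1 := hS s ((hroot s).2 h0)
    exact nyquistContour_ne h1.1 h1.2 hs (sub_self s)
  have hlog : ∀ s ∈ nyquistContour R, logDeriv (fun s : ℂ => aeval s q) s =
      (Q.roots.map fun a => 1 / (s - a)).sum := fun s hs => by
    have h1 : (fun s : ℂ => aeval s q) = fun s => Q.eval s := by
      funext s; rw [hQ, eval_map_algebraMap]
    have h2 : Q.eval s ≠ 0 := by rw [hQ, eval_map_algebraMap]; exact hne s hs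
    rw [h1, logDeriv_apply, Polynomial.deriv,
      (IsAlgClosed.splits Q).eval_derivative_div_eval_of_ne_zero h2]
  obtain ⟨hc, hi⟩ := nyquistIntegral_sum_inv_sub Q.roots hR hS
  refine ⟨hne, hc.congr hlog, ?_⟩
  rw [nyquistIntegral_congr hR hlog, hi]

theorem IsHurwitz.eventually_nyquistIntegral {q : ℝ[X]} (hq : IsHurwitz q) :
    ∀ᶠ R : ℝ in atTop, (∀ s ∈ nyquistContour R, aeval s q ≠ 0) ∧
      ContinuousOn (logDeriv fun s : ℂ => aeval s q) (nyquistContour R) ∧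
      nyquistIntegral (logDeriv fun s : ℂ => aeval s q) R = 0 := by
  have hQ0 : q.map (algebraMap ℝ ℂ) ≠ 0 :=
    (Polynomial.map_ne_zero_iff (algebraMap ℝ ℂ).injective).2 hq.ne_zero
  refine (eventually_nyquistIntegral_logDeriv hq.ne_zero fun z hz => (hq z hz).ne).mono
    fun R ⟨h1, h2, h3⟩ => ⟨h1, h2, ?_⟩
  rw [h3, Multiset.countP_eq_zero.2, Nat.cast_zero, mul_zero]
  intro a ha
  rw [mem_roots hQ0, IsRoot, eval_map_algebraMap] at ha
  exact not_lt.2 (hq a ha).le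

/-- If `q(-s)` is Hurwitz, all zeros of `q` are encircled by large D-contours. -/
theorem IsHurwitz.eventually_nyquistIntegral_comp_neg {q : ℝ[X]} (hq : IsHurwitz (q.comp (-X))) :
    ∀ᶠ R : ℝ in atTop, (∀ s ∈ nyquistContour R, aeval s q ≠ 0) ∧
      ContinuousOn (logDeriv fun s : ℂ => aeval s q) (nyquistContour R) ∧
      nyquistIntegral (logDeriv fun s : ℂ => aeval s q) R =
        -(2 * Real.pi * Complex.I) * q.natDegree := by
  have hq0 : q ≠ 0 := fun h0 => hq.ne_zero (by rw [h0, zero_comp])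
  have hpos : ∀ z : ℂ, aeval z q = 0 → 0 < z.re := fun z hz => by
    have := hq (-z) (by rw [aeval_comp_neg_X, neg_neg, hz])
    simpa using this
  have hQ0 : q.map (algebraMap ℝ ℂ) ≠ 0 :=
    (Polynomial.map_ne_zero_iff (algebraMap ℝ ℂ).injective).2 hq0
  refine (eventually_nyquistIntegral_logDeriv hq0 fun z hz => (hpos z hz).ne').mono
    fun R ⟨h1, h2, h3⟩ => ⟨h1, h2, ?_⟩
  rw [h3, Multiset.countP_eq_card.2, ← (IsAlgClosed.splits _).natDegree_eq_card_roots,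
    natDegree_map]
  intro a ha
  rw [mem_roots hQ0, IsRoot, eval_map_algebraMap] at ha
  exact hpos a ha

/-- The winding number of `h(s) / (D₂(-s) D₁(s))` counts the zeros of `D₂(-s)` minus those of `h`
in the right half-plane. -/
theorem hasWno_zero_iff {h hplus hminus D₁ D₂ : ℝ[X]} (hh : IsCanonicalFactorization h hplus hminus)
    (h₁ : IsHurwitz D₁) (h₂ : IsHurwitz D₂) {g : ℂ → ℂ}
    (hg : ∀ s, g s = aeval s h / (aeval (-s) D₂ * aeval s D₁)) :
    HasWno g 0 ↔ hminus.natDegree = D₂.natDegree := by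
  have h₂' : IsHurwitz ((D₂.comp (-X)).comp (-X)) := by rwa [comp_neg_X_comp_neg_X]
  have hg' : g = fun s => (aeval s hplus * aeval s hminus) /
      (aeval s (D₂.comp (-X)) * aeval s D₁) := by
    funext s
    rw [hg, hh.eq_mul, map_mul, aeval_comp_neg_X]
  have key : ∀ᶠ R : ℝ in atTop, (∀ s ∈ nyquistContour R, AnalyticAt ℂ g s ∧ g s ≠ 0) ∧
      nyquistIntegral (logDeriv g) R =
        (2 * Real.pi * Complex.I) * ((D₂.natDegree : ℂ) - hminus.natDegree) := by
    filter_upwards [hh.plus.eventually_nyquistIntegral,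
      hh.minus.eventually_nyquistIntegral_comp_neg, h₁.eventually_nyquistIntegral,
      h₂'.eventually_nyquistIntegral_comp_neg, eventually_ge_atTop 0]
      with R ⟨p1, p2, p3⟩ ⟨m1, m2, m3⟩ ⟨d1, d2, d3⟩ ⟨e1, e2, e3⟩ hR
    have han : ∀ (q : ℝ[X]) (s : ℂ), AnalyticAt ℂ (fun s : ℂ => aeval s q) s := fun q s =>
      AnalyticAt.aeval_polynomial analyticAt_id q
    refine ⟨fun s hs => ⟨?_, ?_⟩, ?_⟩
    · rw [hg']
      exact ((han _ s).mul (han _ s)).div ((han _ s).mul (han _ s))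
        (mul_ne_zero (e1 s hs) (d1 s hs))
    · rw [hg']
      exact div_ne_zero (mul_ne_zero (p1 s hs) (m1 s hs)) (mul_ne_zero (e1 s hs) (d1 s hs))
    · have hlog : ∀ s ∈ nyquistContour R, logDeriv g s =
          (logDeriv (fun s : ℂ => aeval s hplus) s + logDeriv (fun s : ℂ => aeval s hminus) s) -
          (logDeriv (fun s : ℂ => aeval s (D₂.comp (-X))) s +
            logDeriv (fun s : ℂ => aeval s D₁) s) := fun s hs => by
        rw [hg', logDeriv_div (f := fun s : ℂ => aeval s hplus * aeval s hminus)
            (g := fun s : ℂ => aeval s (D₂.comp (-X)) * aeval s D₁) s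
            (mul_ne_zero (p1 s hs) (m1 s hs)) (mul_ne_zero (e1 s hs) (d1 s hs))
            ((han _ s).mul (han _ s)).differentiableAt ((han _ s).mul (han _ s)).differentiableAt,
          logDeriv_mul s (p1 s hs) (m1 s hs) (han _ s).differentiableAt
            (han _ s).differentiableAt,
          logDeriv_mul s (e1 s hs) (d1 s hs) (han _ s).differentiableAt
            (han _ s).differentiableAt]
      have hc1 : ContinuousOn (fun s => logDeriv (fun s : ℂ => aeval s hplus) s +
          logDeriv (fun s : ℂ => aeval s hminus) s) (nyquistContour R) := p2.add m2
      have hc2 : ContinuousOn (fun s => logDeriv (fun s : ℂ => aeval s (D₂.comp (-X))) s +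
          logDeriv (fun s : ℂ => aeval s D₁) s) (nyquistContour R) := e2.add d2
      rw [nyquistIntegral_congr hR hlog, nyquistIntegral_sub hR hc1 hc2,
        nyquistIntegral_add hR p2 m2, nyquistIntegral_add hR e2 d2, p3, m3, d3, e3,
        natDegree_comp, natDegree_neg, natDegree_X, mul_one]
      ring
  have hpi : (2 * Real.pi * Complex.I) ≠ 0 := by
    simp [Real.pi_ne_zero]
  constructor
  · intro hw
    obtain ⟨R, ⟨-, hR1⟩, -, hR2⟩ := (hw.and key).exists
    rw [hR2, inv_mul_cancel_left₀ hpi, Int.cast_zero, sub_eq_zero] at hR1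
    exact_mod_cast hR1.symm
  · intro hd
    refine key.mono fun R ⟨hR1, hR2⟩ => ⟨hR1, ?_⟩
    rw [hR2, hd]
    simp

end Winding

/-! ### Canonical factorizations -/

section CanonicalFactorization

/-- A polynomial without zeros on the axis is sorted, one irreducible factor at a time, into a
factor with zeros on the left and a factor with zeros on the right. -/
theorem exists_isCanonicalFactorization {h : ℝ[X]}
    (hax : ∀ z : ℂ, aeval z h = 0 → z.re ≠ 0) :
    ∃ hplus hminus, IsCanonicalFactorization h hplus hminus := by
  have h0 : h ≠ 0 := by
    rintro rfl
    exact hax 0 (by simp) (by simp)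
  induction hn : h.natDegree using Nat.strong_induction_on generalizing h with
  | _ n ih =>
  by_cases hu : IsUnit h
  · refine ⟨h, 1, by simp, isHurwitz_of_isUnit hu, ?_⟩
    rw [one_comp]
    exact isHurwitz_of_isUnit isUnit_one
  obtain ⟨z, hz⟩ := IsAlgClosed.exists_root (h.map (algebraMap ℝ ℂ)) (by
    rw [degree_map]
    exact fun hd => hu (isUnit_iff_degree_eq_zero.2 hd))
  rw [IsRoot, eval_map_algebraMap] at hz
  obtain ⟨r, hr, ⟨q, rfl⟩, hrz⟩ := exists_irreducible_dvd_of_aeval_eq_zero hz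
  have hq0 := right_ne_zero_of_mul h0
  obtain ⟨f, g, hfg, hf, hg⟩ := ih q.natDegree (by
    rw [← hn, natDegree_mul hr.ne_zero hq0]
    have := hr.natDegree_pos
    omega) (fun w hw => hax w (by rw [map_mul, hw, mul_zero])) hq0 rfl
  rcases lt_or_gt_of_ne (hax z hz) with hlt | hgt
  · refine ⟨r * f, g, by rw [hfg, mul_assoc], IsHurwitz.mul (fun w hw => ?_) hf, hg⟩
    rwa [hrz w hw]
  · refine ⟨f, r * g, by rw [hfg]; ring, hf, ?_⟩
    rw [mul_comp]
    refine IsHurwitz.mul (fun w hw => ?_) hg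
    rw [aeval_comp_neg_X] at hw
    have := hrz _ hw
    rw [Complex.neg_re] at this
    linarith

/-- The substitution of `-s` exchanges the two factors. -/
theorem IsCanonicalFactorization.comp_neg_X {h hplus hminus : ℝ[X]}
    (hh : IsCanonicalFactorization h hplus hminus) :
    IsCanonicalFactorization (h.comp (-X)) (hminus.comp (-X)) (hplus.comp (-X)) where
  eq_mul := by rw [hh.eq_mul, mul_comp, mul_comm]
  plus := hh.minus
  minus := by rw [comp_neg_X_comp_neg_X]; exact hh.plus

theorem natDegree_comp_neg_X (q : ℝ[X]) : (q.comp (-X)).natDegree = q.natDegree := by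
  rw [natDegree_comp, natDegree_neg, natDegree_X, mul_one]

theorem IsCanonicalFactorization.natDegree_add {h hplus hminus : ℝ[X]}
    (hh : IsCanonicalFactorization h hplus hminus) :
    hplus.natDegree + hminus.natDegree = h.natDegree := by
  rw [hh.eq_mul, natDegree_mul hh.plus.ne_zero]
  intro h0
  exact hh.minus.ne_zero (by rw [h0, zero_comp])

end CanonicalFactorization

/-! ### The v-gap and the degree of the anti-Hurwitz factor -/

section VGap

variable {k p : ℕ} {S₁ S₂ : LTISystem k p}
  {n₁ : Matrix (Fin p) (Fin k) ℝ[X]} {m₁ : Matrix (Fin k) (Fin k) ℝ[X]}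
  {n₂ : Matrix (Fin p) (Fin k) ℝ[X]} {m₂ : Matrix (Fin k) (Fin k) ℝ[X]}

/-- The polynomial `h` of the time-conjugate systems is `h(-s)`. -/
theorem crossDet_comp_neg_X :
    crossDet (n₁.map fun q => q.comp (-X)) (m₁.map fun q => q.comp (-X))
      (n₂.map fun q => q.comp (-X)) (m₂.map fun q => q.comp (-X)) =
        (crossDet n₁ m₁ n₂ m₂).comp (-X) := by
  rw [crossDet, crossDet, ← det_map_comp_neg_X]
  congr 1
  have h := fun (a b c : ℕ) (A : Matrix (Fin a) (Fin b) ℝ[X]) (B : Matrix (Fin b) (Fin c) ℝ[X]) =>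
    Matrix.map_mul (L := A) (M := B) (f := compRingHom (-X : ℝ[X]))
  have h' := Matrix.map_add (compRingHom (-X : ℝ[X])) (map_add _)
    (paraTranspose m₂ * m₁) (paraTranspose n₂ * n₁)
  rw [h, h] at h'
  exact h'.symm

/-- `det (G₂(-s)ᵀ G₁(s)) = h(s) / (det d₂(-s) det d₁(s))`; at the zeros of the denominator both
sides are zero by convention. -/
theorem det_graphSymbol_transpose_mul {d₁ d₂ : Matrix (Fin k) (Fin k) ℝ[X]}
    (h₁ : ∀ s : ℂ, S₁.graphSymbol s = Matrix.fromRows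
      (evalMatrix s m₁ * (evalMatrix s d₁)⁻¹) (evalMatrix s n₁ * (evalMatrix s d₁)⁻¹))
    (h₂ : ∀ s : ℂ, S₂.graphSymbol s = Matrix.fromRows
      (evalMatrix s m₂ * (evalMatrix s d₂)⁻¹) (evalMatrix s n₂ * (evalMatrix s d₂)⁻¹)) (s : ℂ) :
    ((S₂.graphSymbol (-s))ᵀ * S₁.graphSymbol s).det =
      aeval s (crossDet n₁ m₁ n₂ m₂) / (aeval (-s) d₂.det * aeval s d₁.det) := by
  have h : (S₂.graphSymbol (-s))ᵀ * S₁.graphSymbol s = (evalMatrix (-s) d₂)⁻¹ᵀ *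
      evalMatrix s (paraTranspose m₂ * m₁ + paraTranspose n₂ * n₁) * (evalMatrix s d₁)⁻¹ := by
    rw [h₁, h₂, Matrix.transpose_fromRows, Matrix.fromCols_mul_fromRows]
    simp only [evalMatrix_add, evalMatrix_mul, evalMatrix_paraTranspose, Matrix.transpose_mul,
      Matrix.mul_add, Matrix.add_mul, Matrix.mul_assoc]
  rw [h, Matrix.det_mul, Matrix.det_mul, Matrix.det_transpose, Matrix.det_nonsing_inv,
    Matrix.det_nonsing_inv, Ring.inverse_eq_inv', det_evalMatrix,
    det_evalMatrix, det_evalMatrix, ← crossDet, div_eq_mul_inv, mul_inv]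
  ring

/-- The analogue of `det_graphSymbol_transpose_mul` with `G₂(s)ᴴ` for `G₂(-s)ᵀ`, in modulus on the
axis. -/
theorem det_graphSymbol_conjTranspose_mul {d₁ d₂ : Matrix (Fin k) (Fin k) ℝ[X]}
    (h₁ : ∀ s : ℂ, S₁.graphSymbol s = Matrix.fromRows
      (evalMatrix s m₁ * (evalMatrix s d₁)⁻¹) (evalMatrix s n₁ * (evalMatrix s d₁)⁻¹))
    (h₂ : ∀ s : ℂ, S₂.graphSymbol s = Matrix.fromRows
      (evalMatrix s m₂ * (evalMatrix s d₂)⁻¹) (evalMatrix s n₂ * (evalMatrix s d₂)⁻¹)) (ω : ℝ) :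
    ‖((S₂.graphSymbol (ω * Complex.I))ᴴ * S₁.graphSymbol (ω * Complex.I)).det‖ =
      ‖aeval ((ω : ℂ) * Complex.I) (crossDet n₁ m₁ n₂ m₂)‖ /
        ‖aeval ((ω : ℂ) * Complex.I) (d₁.det * d₂.det)‖ := by
  have h : (S₂.graphSymbol (ω * Complex.I))ᴴ * S₁.graphSymbol (ω * Complex.I) =
      (evalMatrix (ω * Complex.I) d₂)⁻¹ᴴ *
      evalMatrix (ω * Complex.I) (paraTranspose m₂ * m₁ + paraTranspose n₂ * n₁) *
        (evalMatrix (ω * Complex.I) d₁)⁻¹ := by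
    rw [h₁, h₂, Matrix.conjTranspose_fromRows_eq_fromCols_conjTranspose,
      Matrix.fromCols_mul_fromRows]
    simp only [evalMatrix_add, evalMatrix_mul, evalMatrix_paraTranspose_axis,
      Matrix.conjTranspose_mul, Matrix.mul_add, Matrix.add_mul, Matrix.mul_assoc]
  rw [h, Matrix.det_mul, Matrix.det_mul, Matrix.det_conjTranspose, Matrix.det_nonsing_inv,
    Matrix.det_nonsing_inv, Ring.inverse_eq_inv', det_evalMatrix,
    det_evalMatrix, det_evalMatrix, ← crossDet]
  simp only [norm_mul, norm_star, norm_inv, map_mul]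
  rw [div_eq_mul_inv, mul_inv]
  ring

/-- On the axis `h` is bounded above and below by constant multiples of `det d₁ det d₂`. -/
theorem crossDet_axis_and_natDegree (h₁ : IsRightCoprimeFraction S₁.transferFunction n₁ m₁)
    (h₂ : IsRightCoprimeFraction S₂.transferFunction n₂ m₂) (hgap : gapL2 S₁ S₂ < 1) :
    (∀ z : ℂ, aeval z (crossDet n₁ m₁ n₂ m₂) = 0 → z.re ≠ 0) ∧
    (crossDet n₁ m₁ n₂ m₂).natDegree = S₁.mcMillanDegree + S₂.mcMillanDegree := by
  obtain ⟨d₁, hd₁, hG₁⟩ := LTISystem.exists_graphSymbol_eq h₁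
  obtain ⟨d₂, hd₂, hG₂⟩ := LTISystem.exists_graphSymbol_eq h₂
  have hA₁ := (LTISystem.isGraphSymbol_graphSymbol h₁).isAxisIsometry
  have hA₂ := (LTISystem.isGraphSymbol_graphSymbol h₂).isAxisIsometry
  obtain ⟨c, hc, hlow⟩ := exists_det_lower_bound hA₁ hA₂ hgap
  have hD : ∀ ω : ℝ, 0 < ‖aeval ((ω : ℂ) * Complex.I) (d₁.det * d₂.det)‖ := fun ω =>
    norm_pos_iff.2 ((hd₁.hurwitz.mul hd₂.hurwitz).axis_ne_zero ω)
  have hlow' : ∀ ω : ℝ, c * ‖aeval ((ω : ℂ) * Complex.I) (d₁.det * d₂.det)‖ ≤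
      ‖aeval ((ω : ℂ) * Complex.I) (crossDet n₁ m₁ n₂ m₂)‖ := fun ω => by
    have := hlow ω
    rwa [det_graphSymbol_conjTranspose_mul hG₁ hG₂, le_div_iff₀ (hD ω)] at this
  have hup : ∀ ω : ℝ, ‖aeval ((ω : ℂ) * Complex.I) (crossDet n₁ m₁ n₂ m₂)‖ ≤
      (Fintype.card (Fin k)).factorial *
        ‖aeval ((ω : ℂ) * Complex.I) (d₁.det * d₂.det)‖ := fun ω => by
    have := det_upper_bound (hA₁.isometry ω) (hA₂.isometry ω)
    rwa [det_graphSymbol_conjTranspose_mul hG₁ hG₂, div_le_iff₀ (hD ω)] at this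
  refine ⟨fun z hz hre => ?_, ?_⟩
  · have hz' : (z.im : ℂ) * Complex.I = z := by apply Complex.ext <;> simp [hre]
    have h3 := hlow' z.im
    have h4 := hD z.im
    rw [hz'] at h3 h4
    rw [hz, norm_zero] at h3
    nlinarith
  · rw [LTISystem.mcMillanDegree_eq_natDegree_det h₁,
      LTISystem.mcMillanDegree_eq_natDegree_det h₂,
      ← LTISystem.natDegree_det_spectralFactor h₁ hd₁,
      ← LTISystem.natDegree_det_spectralFactor h₂ hd₂,
      ← natDegree_mul hd₁.hurwitz.ne_zero hd₂.hurwitz.ne_zero]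
    refine le_antisymm (natDegree_le_of_norm_le _ (Eventually.of_forall hup))
      (natDegree_le_of_norm_le c⁻¹ (Eventually.of_forall fun ω => ?_))
    rw [inv_mul_eq_div, le_div_iff₀' hc]
    exact hlow' ω

/-- The winding number is `μ₂ - deg h₋`, and the `L₂`-gap is less than `1` by assumption. -/
theorem vGap_lt_one_iff (h₁ : IsRightCoprimeFraction S₁.transferFunction n₁ m₁)
    (h₂ : IsRightCoprimeFraction S₂.transferFunction n₂ m₂) (hgap : gapL2 S₁ S₂ < 1)
    {hplus hminus : ℝ[X]}
    (hh : IsCanonicalFactorization (crossDet n₁ m₁ n₂ m₂) hplus hminus) :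
    vGap S₁ S₂ < 1 ↔ hminus.natDegree = S₂.mcMillanDegree := by
  obtain ⟨d₁, hd₁, hG₁⟩ := LTISystem.exists_graphSymbol_eq h₁
  obtain ⟨d₂, hd₂, hG₂⟩ := LTISystem.exists_graphSymbol_eq h₂
  rw [LTISystem.mcMillanDegree_eq_natDegree_det h₂,
    ← LTISystem.natDegree_det_spectralFactor h₂ hd₂,
    ← hasWno_zero_iff hh hd₁.hurwitz hd₂.hurwitz (det_graphSymbol_transpose_mul hG₁ hG₂), vGap]
  split_ifs with hw
  · exact ⟨fun _ => hw, fun _ => hgap⟩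
  · exact ⟨fun h => absurd h (lt_irrefl 1), fun h => absurd h hw⟩

theorem vGap_eq_gapL2_of_lt_one (h : vGap S₁ S₂ < 1) : vGap S₁ S₂ = gapL2 S₁ S₂ := by
  rw [vGap] at h ⊢
  split_ifs at h ⊢ with hw
  · rfl
  · exact absurd h (lt_irrefl 1)

end VGap

theorem proposition7 {k p : ℕ} (P₁ P₂ : LTISystem k p)
    (n₁ : Matrix (Fin p) (Fin k) ℝ[X]) (m₁ : Matrix (Fin k) (Fin k) ℝ[X])
    (n₂ : Matrix (Fin p) (Fin k) ℝ[X]) (m₂ : Matrix (Fin k) (Fin k) ℝ[X])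
    (h₁ : IsRightCoprimeFraction P₁.transferFunction n₁ m₁)
    (h₂ : IsRightCoprimeFraction P₂.transferFunction n₂ m₂)
    (hgap : gapL2 P₁ P₂ < 1) :
    (∃ hplus hminus : ℝ[X],
      IsCanonicalFactorization (crossDet n₁ m₁ n₂ m₂) hplus hminus) ∧
    ∀ hplus hminus : ℝ[X],
      IsCanonicalFactorization (crossDet n₁ m₁ n₂ m₂) hplus hminus →
      List.TFAE [vGapForward P₁ P₂ < 1,
        hplus.natDegree = P₁.mcMillanDegree,
        hminus.natDegree = P₂.mcMillanDegree] ∧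
      List.TFAE [vGapBackward P₁ P₂ < 1,
        hminus.natDegree = P₁.mcMillanDegree,
        hplus.natDegree = P₂.mcMillanDegree] ∧
      ((vGapForward P₁ P₂ = vGapBackward P₁ P₂ ∧ vGapForward P₁ P₂ < 1) ↔
        (P₁.mcMillanDegree = P₂.mcMillanDegree ∧
          P₂.mcMillanDegree = hplus.natDegree ∧
          hplus.natDegree = hminus.natDegree)) := by
  obtain ⟨hax, hdeg⟩ := crossDet_axis_and_natDegree h₁ h₂ hgap
  refine ⟨exists_isCanonicalFactorization hax, fun hplus hminus hh => ?_⟩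
  have hsum := hh.natDegree_add
  rw [hdeg] at hsum
  have h₁' := LTISystem.isRightCoprimeFraction_timeConj h₁
  have h₂' := LTISystem.isRightCoprimeFraction_timeConj h₂
  have hgap' : gapL2 P₁.timeConj P₂.timeConj = gapL2 P₁ P₂ := gapL2_timeConj h₁ h₂
  have hf : vGapForward P₁ P₂ < 1 ↔ hminus.natDegree = P₂.mcMillanDegree :=
    vGap_lt_one_iff h₁ h₂ hgap hh
  -- The factors of `h(-s)` are `h₋(-s)` and `h₊(-s)`.
  have hb : vGapBackward P₁ P₂ < 1 ↔ hplus.natDegree = P₂.mcMillanDegree := by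
    have h := vGap_lt_one_iff h₁' h₂' (hgap'.trans_lt hgap)
      (hplus := hminus.comp (-X)) (hminus := hplus.comp (-X))
      (by rw [crossDet_comp_neg_X]; exact hh.comp_neg_X)
    rw [natDegree_comp_neg_X, LTISystem.mcMillanDegree_eq_natDegree_det h₂',
      det_map_comp_neg_X, natDegree_comp_neg_X,
      ← LTISystem.mcMillanDegree_eq_natDegree_det h₂] at h
    exact h
  refine ⟨?_, ?_, ?_⟩
  · tfae_have 1 ↔ 3 := hf
    tfae_have 2 ↔ 3 := by omega
    tfae_finish
  · tfae_have 1 ↔ 3 := hb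
    tfae_have 2 ↔ 3 := by omega
    tfae_finish
  · constructor
    · rintro ⟨heq, hlt⟩
      have h3 := hf.1 hlt
      have h4 := hb.1 (heq.symm.trans_lt hlt)
      omega
    · rintro ⟨h3, h4, h5⟩
      have h6 : vGapForward P₁ P₂ < 1 := hf.2 (by omega)
      have h7 : vGapBackward P₁ P₂ < 1 := hb.2 (by omega)
      refine ⟨?_, h6⟩
      rw [vGapForward] at h6 ⊢
      rw [vGapBackward] at h7 ⊢
      rw [vGap_eq_gapL2_of_lt_one h6, vGap_eq_gapL2_of_lt_one h7, hgap']
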